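/- **Setting.** Let $p:\mathbb R\to\mathbb R$ be a square-integrable pulse with matched-filter response $g(t)=\int p(s)\,p(s-t)\,ds$, and let $G\ge 0$ be the Fourier transform of $g$, that is, $g(t)=\int G(f)e^{j2\pi ft}\,df$. Let $T>0$ be the Nyquist period and $\beta\ge 0$ the roll-off factor: $G$ is bounded, is nonzero exactly for $|f|<\frac{1+\beta}{2T}$, and is continuous there. Let $0<\delta<\frac1{1+\beta}$ be the acceleration factor, $P_k>0$ the transmit power, $\sigma_0^2>0$ the noise level (so the transmit SNR $P_k/\sigma_0^2$ is fixed), and $h\in\mathbb C\setminus\{0\}$ the SISO channel gain. For $N=2M+1$ symbols let $(\mathbf G)_{n,m}=g((n-m)\delta T)$, let $\mathcal G(f)=\frac1{\delta T}\sum_{m\in\mathbb Z}G\!\left(\frac{f-m}{\delta T}\right)$, let $\mathbf D$ be the DFT matrix $(\mathbf D)_{m,i}=\frac1{\sqrt N}e^{-j2\pi mi/N}$ ($0\le m\le N-1$, $-M\le i\le M$), and let $\tilde{\mathbf G}=\mathbf D\,\mathrm{diag}\big(\mathcal G(i/N)\big)_{|i|\le M}\mathbf D^\dagger$ be the large-$N$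 form of $\mathbf G$. For a positive semidefinite input covariance matrix $\mathbf Q$, the FTN channel $\mathbf y=h\tilde{\mathbf G}\mathbf a+\boldsymbol\eta$, $\boldsymbol\eta\sim\mathcal{CN}(0,\sigma_0^2\tilde{\mathbf G})$, has transmit power $\frac{1}{N\delta T}\operatorname{tr}(\mathbf Q\tilde{\mathbf G})$ and rate $R_N(\mathbf Q)=\frac1{N\delta T}\log_2\det\!\big(\mathbf I+\tfrac{|h|^2}{\sigma_0^2}\mathbf Q\tilde{\mathbf G}\big)$. A measurable input spectrum $S\ge 0$ has transmit power $\frac1{\delta T}\int_{-1/2}^{1/2}S\,\mathcal G\,df$ (with $S\mathcal G$ integrable) and rate $R(S)=\frac1{\delta T}\int_{-1/2}^{1/2}\log_2\!\big(1+\tfrac{|h|^2}{\sigma_0^2}S\,\mathcal G\big)df$. Let $\phi(f)=\frac{T}{G(f/(\delta T))(1+\beta)}$ for $|f|<\frac{\delta(1+\beta)}2$ and $\phi(f)=0$ for all other $f\in[-\frac12,\frac12]$. Let $Z$ be the number of nonzero samples $\phi(i/N)$, $|i|\le M$, and let $$\boldsymbol\Sigma_N=P_k\,\delta T\,\mathbf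 D\boldsymbol\Lambda^{-1}\mathbf D^\dagger,\qquad \boldsymbol\Lambda^{-1}=\mathrm{diag}(\tilde\lambda_i)_{|i|\le M},\qquad \tilde\lambda_i=\begin{cases}\dfrac{T}{G\!\left(\frac{i}{N\delta T}\right)(1+\beta)},&|i|<\frac Z2,\\[2mm]0,&\frac Z2\le|i|\le M.\end{cases}$$ **Theorem.** For $\delta<\frac1{1+\beta}$ and fixed transmit SNR, $\boldsymbol\Sigma_N$ is the optimal input covariance matrix for SISO FTN in the large-block regime, in the following sense. 1. $\frac1N\|\mathbf G-\tilde{\mathbf G}\|_F^2\to0$ as $N\to\infty$. 2. $P_k\delta T\,\phi$ has transmit power at most $P_k$ and maximizes $R(S)$ over all spectra $S$ of transmit power at most $P_k$. Every maximizer equals it almost everywhere on $\{f\in[-\frac12,\frac12]:\mathcal G(f)\ne0\}$. 3. $\tilde\lambda_i=\phi(i/N)$ for all $|i|\le M$. 4. For every $N$, $\boldsymbol\Sigma_N$ is positive semidefinite and maximizes $R_N$ over all positive semidefinite $\mathbf Q$ whose transmit power does not exceed that of $\boldsymbol\Sigma_N$. Every such maximizer satisfies $\tilde{\mathbf G}\mathbf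 Q\tilde{\mathbf G}=\tilde{\mathbf G}\boldsymbol\Sigma_N\tilde{\mathbf G}$. 5. As $N\to\infty$, the transmit power of $\boldsymbol\Sigma_N$ tends to $P_k$ and $R_N(\boldsymbol\Sigma_N)\to R(P_k\delta T\,\phi)$. 6. For every $\varepsilon>0$ and all sufficiently large $N$, $R_N(\mathbf Q)\le R_N(\boldsymbol\Sigma_N)+\varepsilon$ for every positive semidefinite $\mathbf Q$ of transmit power at most $P_k$. -/

import Mathlib

open MeasureTheory Filter Topology Matrix
open scoped ComplexOrder

noncomputable section

namespace FTN

/-- Matched-filter response `g = p ⋆ p(-·)` of a real pulse `p`. -/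
def matchedResponse (p : ℝ → ℝ) (t : ℝ) : ℝ := ∫ s, p s * p (s - t)

/-- `G` is the Fourier transform of the matched-filter response `g` of the pulse `p`
(written as the inversion formula, which also makes sense when `g` is not integrable,
as for sinc pulses), and the pulse has Nyquist period `T` and roll-off factor `β`: the
band in which `G` does not vanish is `|f| < (1 + β) / (2T)`. -/
structure IsPulseSpectrum (p : ℝ → ℝ) (T β : ℝ) (G : ℝ → ℝ) : Prop where
  memLp : MemLp p 2 volume
  inversion : ∀ t : ℝ, (matchedResponse p t : ℂ) =
    ∫ f : ℝ, (G f : ℂ) * Complex.exp (2 * Real.pi * Complex.I * f * t)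
  nonneg : ∀ f, 0 ≤ G f
  band : ∀ f, G f ≠ 0 ↔ |f| < (1 + β) / (2 * T)
  continuousOn : ContinuousOn G (Set.Ioo (-((1 + β) / (2 * T))) ((1 + β) / (2 * T)))
  bounded : ∃ B, ∀ f, G f ≤ B

/-- The block length `N = 2M + 1`. -/
abbrev blockLength (M : ℕ) : ℕ := 2 * M + 1

/-- The frequency index `i ∈ {-M, …, M}` attached to a position in `{0, …, 2M}`. -/
def freqIndex (M : ℕ) (j : Fin (blockLength M)) : ℤ := (j : ℤ) - M

/-- The FTN intersymbol-interference matrix, `(G)_{n,m} = g((n - m) δ T)`. -/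
def toeplitzISI (p : ℝ → ℝ) (δ T : ℝ) (M : ℕ) :
    Matrix (Fin (blockLength M)) (Fin (blockLength M)) ℂ :=
  Matrix.of fun n m => (matchedResponse p (((n : ℝ) - (m : ℝ)) * δ * T) : ℂ)

/-- The (closed form of the) generating function of the Toeplitz matrix:
`(1 / δT) ∑_m G((f - m) / δT)`. -/
def foldedSpectrum (G : ℝ → ℝ) (δ T f : ℝ) : ℝ :=
  1 / (δ * T) * ∑' m : ℤ, G ((f - m) / (δ * T))

/-- The DFT matrix `(D)_{m,i} = exp(-2π𝐣 m i / N) / √N`, with `m = 0, …, N - 1` and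
`i = -M, …, M`. -/
def dftMatrix (M : ℕ) : Matrix (Fin (blockLength M)) (Fin (blockLength M)) ℂ :=
  Matrix.of fun m j => ((1 / Real.sqrt (blockLength M) : ℝ) : ℂ) *
    Complex.exp (-2 * Real.pi * Complex.I * ((m : ℕ) : ℂ) * (freqIndex M j : ℂ) /
      (blockLength M : ℂ))

/-- The large-block form `D Λ D†` of the intersymbol-interference matrix, where `Λ` holds the
samples of the generating function at `i / N`. -/
def dftISI (G : ℝ → ℝ) (δ T : ℝ) (M : ℕ) :
    Matrix (Fin (blockLength M)) (Fin (blockLength M)) ℂ :=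
  dftMatrix M *
    Matrix.diagonal (fun j =>
      (foldedSpectrum G δ T ((freqIndex M j : ℝ) / (blockLength M : ℝ)) : ℂ)) *
    (dftMatrix M)ᴴ

/-- Transmit power of a block with input covariance `Q`: the mean energy of
`x(t) = ∑ a[m] p(t - mδT)`, which is `tr (Q G)`, divided by the duration `N δ T`. -/
def transmitPower {M : ℕ} (δ T : ℝ) (A Q : Matrix (Fin (blockLength M)) (Fin (blockLength M)) ℂ) :
    ℝ :=
  1 / (blockLength M * δ * T) * (Q * A).trace.re

/-- Information rate in bits per second of the channel `y = h A a + η`,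
`η ∼ CN(0, σ₀² A)`, with Gaussian input `a ∼ CN(0, Q)`:
`(1 / NδT) log₂ det (I + |h|² / σ₀² Q A)`. The parameter `s` is `σ₀²`. -/
def blockRate {M : ℕ} (δ T : ℝ) (h : ℂ) (s : ℝ)
    (A Q : Matrix (Fin (blockLength M)) (Fin (blockLength M)) ℂ) : ℝ :=
  1 / (blockLength M * δ * T) *
    Real.logb 2 (1 + ((‖h‖ ^ 2 / s : ℝ) : ℂ) • (Q * A)).det.re

/-- Transmit power of a stationary input with power spectrum `S` on `[-1/2, 1/2]`. -/
def spectralPower (G : ℝ → ℝ) (δ T : ℝ) (S : ℝ → ℝ) : ℝ :=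
  1 / (δ * T) * ∫ f in Set.Icc (-(1 / 2) : ℝ) (1 / 2), S f * foldedSpectrum G δ T f

/-- Information rate in bits per second of a stationary Gaussian input with power spectrum `S`
over the same channel. -/
def spectralRate (G : ℝ → ℝ) (δ T : ℝ) (h : ℂ) (s : ℝ) (S : ℝ → ℝ) : ℝ :=
  1 / (δ * T) * ∫ f in Set.Icc (-(1 / 2) : ℝ) (1 / 2),
    Real.logb 2 (1 + ‖h‖ ^ 2 / s * (S f * foldedSpectrum G δ T f))

/-- Input spectra obeying the transmit power constraint `P`. -/
structure AdmissibleSpectrum (G : ℝ → ℝ) (δ T P : ℝ) (S : ℝ → ℝ) : Prop where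
  measurable : Measurable S
  nonneg : ∀ f, 0 ≤ S f
  integrable : IntegrableOn (fun f => S f * foldedSpectrum G δ T f)
    (Set.Icc (-(1 / 2) : ℝ) (1 / 2))
  power_le : spectralPower G δ T S ≤ P

/-- Input covariance matrices obeying the transmit power constraint `P`. -/
structure AdmissibleCovariance {M : ℕ} (δ T P : ℝ)
    (A Q : Matrix (Fin (blockLength M)) (Fin (blockLength M)) ℂ) : Prop where
  posSemidef : Q.PosSemidef
  power_le : transmitPower δ T A Q ≤ P

/-- The spectrum `φ`: `T / (G(f / δT) (1 + β))` in the band, `0` outside. -/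
def phi (G : ℝ → ℝ) (δ T β f : ℝ) : ℝ :=
  if |f| < δ * (1 + β) / 2 then T / (G (f / (δ * T)) * (1 + β)) else 0

/-- `Z`: the number of nonzero samples among `φ(i / N)`, `i = -M, …, M`. -/
def numNonzero (G : ℝ → ℝ) (δ T β : ℝ) (M : ℕ) : ℕ :=
  Set.ncard {i : ℤ | |i| ≤ M ∧ phi G δ T β ((i : ℝ) / (blockLength M : ℝ)) ≠ 0}

/-- The entries of `Λ⁻¹`: `T / (G(i / NδT) (1 + β))` for `|i| < Z / 2`, `0` otherwise. -/
def lambdaTilde (G : ℝ → ℝ) (δ T β : ℝ) (M : ℕ) (i : ℤ) : ℝ :=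
  if |(i : ℝ)| < (numNonzero G δ T β M : ℝ) / 2 then
    T / (G ((i : ℝ) / (blockLength M * δ * T)) * (1 + β))
  else 0

/-- `Σ = P δ T D Λ⁻¹ D†`. -/
def optCovariance (G : ℝ → ℝ) (δ T β P : ℝ) (M : ℕ) :
    Matrix (Fin (blockLength M)) (Fin (blockLength M)) ℂ :=
  ((P * δ * T : ℝ) : ℂ) •
    (dftMatrix M * Matrix.diagonal (fun j => (lambdaTilde G δ T β M (freqIndex M j) : ℂ)) *
      (dftMatrix M)ᴴ)

end FTN

end

/-!
With `N = 2M + 1` samples, the folded spectrum restricted to `[-1/2, 1/2]` is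
`F f = G (f / δT) / δT`: faster-than-Nyquist signalling with `δ (1 + β) < 1` leaves no aliasing, and
`F` vanishes outside the band `|f| < δ (1 + β) / 2`. Multiplying `F` by the input spectrum
`P δ T φ` gives the flat received spectrum `P T / (1 + β)` on the band (`FTN.flatSpectrum`).

*Optimality.* A flat received spectrum is optimal because the tangent of the concave rate at a flat
point sees the input only through its total received power, which is the transmit power. For
spectra this is the scalar tangent bound of `log (1 + c u)`, integrated
(`FTN.integral_log_one_add_le`). For covariances, put `K = D Λ^{1/2}` and `B = K† Q K`, so that, up to
constants, the rate is `log det (1 + c B)` and the power is `tr B`. The tangent bound of the log-determinant at a diagonal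
matrix (`Matrix.PosSemidef.log_det_one_add_smul_le`) follows from `log det C ≤ tr C - n` for positive
definite `C`, that is from `log μ ≤ μ - 1` for its eigenvalues, and needs no Hadamard inequality. It
yields `R(Q) ≤ R(Σ) + κ (power Q - power Σ)` with its equality case
(`FTN.IsPulseSpectrum.blockRate_le`), hence optimality at every block length at the power of `Σ`, and
asymptotic optimality at power `P`, once the power of `Σ` is known to tend to `P`.

*Limits.* Power and rate of `Σ` are Riemann sums over the grid `i / N`, `|i| ≤ M`. These converge
for bounded, almost everywhere continuous functions (`FTN.tendsto_riemannSum`), such as functions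
continuous on the band and zero outside it.

*Asymptotic equivalence.* `D Λ D†` is the circulant matrix of the discrete Fourier coefficients of
the samples of `F`, and the Toeplitz matrix holds the Fourier coefficients of `F`. By Riemann sums
the former converge to the latter one by one, and by the two Parseval identities so do their
energies; in `ℓ²` this gives norm convergence (`FTN.tendsto_tsum_norm_sub_sq`). The entries where the
circulant matrix wraps around are too few to matter (`FTN.tendsto_toeplitz_sub_circulant`).
-/

namespace Matrix

/-! ### The log-determinant of a positive definite matrix -/

section LogDet

variable {n : Type*} [Fintype n] [DecidableEq n]

/-- The inequality `log μ ≤ μ - 1`, summed over the eigenvalues. -/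
theorem PosDef.log_det_le {C : Matrix n n ℂ} (hC : C.PosDef) :
    Real.log C.det.re ≤ C.trace.re - Fintype.card n := by
  have hdet : C.det.re = ∏ i, hC.isHermitian.eigenvalues i := by
    rw [hC.isHermitian.det_eq_prod_eigenvalues]
    simp [← Complex.ofReal_prod]
  have htr : C.trace.re = ∑ i, hC.isHermitian.eigenvalues i := by
    rw [hC.isHermitian.trace_eq_sum_eigenvalues]
    simp
  rw [hdet, htr, Real.log_prod fun i _ => (hC.eigenvalues_pos i).ne']
  calc _ ≤ ∑ i, (hC.isHermitian.eigenvalues i - 1) :=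
        Finset.sum_le_sum fun i _ => Real.log_le_sub_one_of_pos (hC.eigenvalues_pos i)
    _ = _ := by simp

theorem PosDef.eq_one_of_log_det_eq {C : Matrix n n ℂ} (hC : C.PosDef)
    (h : Real.log C.det.re = C.trace.re - Fintype.card n) : C = 1 := by
  have hdet : C.det.re = ∏ i, hC.isHermitian.eigenvalues i := by
    rw [hC.isHermitian.det_eq_prod_eigenvalues]
    simp [← Complex.ofReal_prod]
  have htr : C.trace.re = ∑ i, hC.isHermitian.eigenvalues i := by
    rw [hC.isHermitian.trace_eq_sum_eigenvalues]
    simp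
  rw [hdet, htr, Real.log_prod fun i _ => (hC.eigenvalues_pos i).ne'] at h
  have h' : ∑ i, Real.log (hC.isHermitian.eigenvalues i)
      = ∑ i, (hC.isHermitian.eigenvalues i - 1) := by simp [h]
  rw [Finset.sum_eq_sum_iff_of_le
    fun i _ => Real.log_le_sub_one_of_pos (hC.eigenvalues_pos i)] at h'
  have h1 : hC.isHermitian.eigenvalues = 1 := by
    funext i
    by_contra hne
    exact (Real.log_lt_sub_one_of_pos (hC.eigenvalues_pos i) hne).ne (h' i (Finset.mem_univ i))
  have hs := hC.isHermitian.spectral_theorem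
  rw [h1] at hs
  rw [hs]
  have : (RCLike.ofReal ∘ (1 : n → ℝ) : n → ℂ) = 1 := by funext; simp
  rw [this]
  simp

/-- The tangent bound for the concave function `B ↦ log det (1 + c B)` at the diagonal matrix
with entries `x`, with its equality case. It comes from `log det C ≤ tr C - n` applied to
`C = W^{-1/2} (1 + c B) W^{-1/2}` with `W = 1 + c diag x`. -/
theorem PosSemidef.log_det_one_add_smul_le {B : Matrix n n ℂ} (hB : B.PosSemidef) {c : ℝ}
    (hc : 0 < c) {x : n → ℝ} (hx : ∀ j, 0 ≤ x j) :
    Real.log (1 + (c : ℂ) • B).det.re ≤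
        ∑ j, Real.log (1 + c * x j) + ∑ j, c * ((B j j).re - x j) / (1 + c * x j) ∧
      (Real.log (1 + (c : ℂ) • B).det.re =
        ∑ j, Real.log (1 + c * x j) + ∑ j, c * ((B j j).re - x j) / (1 + c * x j) →
        B = Matrix.diagonal fun j => (x j : ℂ)) := by
  have hpos : ∀ j, 0 < 1 + c * x j := fun j => by have := mul_nonneg hc.le (hx j); linarith
  set w : n → ℂ := fun j => ((1 / Real.sqrt (1 + c * x j) : ℝ) : ℂ) with hw
  have hw0 : ∀ j, w j ≠ 0 := fun j => by
    simp [hw, (Real.sqrt_pos.2 (hpos j)).ne']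
  have hw2 : ∀ j, w j * w j = ((1 / (1 + c * x j) : ℝ) : ℂ) := fun j => by
    simp only [hw]
    rw [← Complex.ofReal_mul]
    congr 1
    rw [div_mul_div_comm, Real.mul_self_sqrt (hpos j).le, one_mul]
  set A : Matrix n n ℂ := 1 + (c : ℂ) • B with hA
  have hApos : A.PosDef := by
    refine PosDef.one.add_posSemidef ?_
    exact hB.smul (by exact_mod_cast hc.le)
  have hstar : (Matrix.diagonal w)ᴴ = Matrix.diagonal w := by
    rw [Matrix.diagonal_conjTranspose]
    congr 1
    funext j
    simp [hw]
  set C := Matrix.diagonal w * A * Matrix.diagonal w with hCdef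
  have hunit : IsUnit (Matrix.diagonal w) := by
    rw [Matrix.isUnit_iff_isUnit_det, Matrix.det_diagonal, isUnit_iff_ne_zero]
    exact Finset.prod_ne_zero_iff.2 fun j _ => hw0 j
  have hC : C.PosDef := by
    have := hApos.conjTranspose_mul_mul_same (B := Matrix.diagonal w)
      (Matrix.mulVec_injective_of_isUnit hunit)
    rwa [hstar] at this
  have hdetA : 0 < A.det.re := by
    have := hApos.det_pos
    exact (Complex.lt_def.1 this).1
  have hdet : C.det = ((∏ j, 1 / (1 + c * x j) : ℝ) : ℂ) * A.det := by
    rw [hCdef, Matrix.det_mul, Matrix.det_mul, Matrix.det_diagonal, mul_right_comm,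
      ← Finset.prod_mul_distrib]
    simp_rw [hw2]
    push_cast
    rfl
  have hlog : Real.log C.det.re = Real.log A.det.re - ∑ j, Real.log (1 + c * x j) := by
    rw [hdet, Complex.re_ofReal_mul, Real.log_mul _ hdetA.ne', Real.log_prod]
    · simp_rw [one_div, Real.log_inv, Finset.sum_neg_distrib]
      ring
    · intro j _
      exact (one_div_pos.2 (hpos j)).ne'
    · exact (Finset.prod_pos fun j _ => one_div_pos.2 (hpos j)).ne'
  have htr : C.trace.re - Fintype.card n = ∑ j, c * ((B j j).re - x j) / (1 + c * x j) := by
    have : ∀ j, (C j j).re = c * ((B j j).re - x j) / (1 + c * x j) + 1 := fun j => by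
      have h1 : C j j = ((1 / (1 + c * x j) : ℝ) : ℂ) * A j j := by
        rw [hCdef, Matrix.mul_diagonal, Matrix.diagonal_mul, mul_right_comm, hw2]
      rw [h1, Complex.re_ofReal_mul, hA]
      simp
      have := (hpos j).ne'
      field_simp
      ring
    rw [Matrix.trace, Complex.re_sum]
    simp only [Matrix.diag_apply]
    simp_rw [this, Finset.sum_add_distrib]
    simp
  constructor
  · have := hC.log_det_le
    linarith
  · intro heq
    have h1 : C = 1 := hC.eq_one_of_log_det_eq (by linarith)
    ext i j
    have hij : w i * A i j * w j = (1 : Matrix n n ℂ) i j := by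
      rw [← h1, hCdef, Matrix.mul_diagonal, Matrix.diagonal_mul]
    have hcc : (c : ℂ) ≠ 0 := by exact_mod_cast hc.ne'
    by_cases h : i = j
    · subst h
      have h2 := hw2 i
      have h3 : ((1 + c * x i : ℝ) : ℂ) ≠ 0 := by exact_mod_cast (hpos i).ne'
      rw [mul_right_comm, h2, hA] at hij
      simp only [Matrix.add_apply, Matrix.one_apply_eq, Matrix.smul_apply, smul_eq_mul,
        Complex.ofReal_div, Complex.ofReal_one] at hij
      rw [one_div, inv_mul_eq_one₀ h3] at hij
      push_cast at hij
      rw [Matrix.diagonal_apply_eq]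
      exact (mul_left_cancel₀ hcc (add_left_cancel hij)).symm
    · rw [Matrix.one_apply_ne h] at hij
      rw [Matrix.diagonal_apply_ne _ h]
      have : A i j = 0 := by
        simpa [hw0] using hij
      rw [hA] at this
      simpa [Matrix.one_apply_ne h, hc.ne'] using this

end LogDet

end Matrix

namespace FTN

/-! ### Riemann sums over the symmetric grid -/

theorem round_grid_eq {N : ℝ} (hN : 0 < N) {k : ℤ} {x : ℝ}
    (hx : x ∈ Set.Ioo (((k : ℝ) - 1 / 2) / N) (((k : ℝ) + 1 / 2) / N)) : round (N * x) = k := by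
  rw [round_eq_iff]
  rw [Set.mem_Ioo, div_lt_iff₀ hN, lt_div_iff₀ hN] at hx
  exact ⟨by linarith [hx.1], by linarith [hx.2]⟩

/-- The `2M + 1` cells of length `1 / N` centred at the points `i / N` tile `[-1/2, 1/2]`, so a
Riemann sum is the integral of a step function. -/
theorem riemannSum_eq_integral_round {E : Type*} [NormedAddCommGroup E] [NormedSpace ℝ E]
    [CompleteSpace E]
    (H : ℝ → E) (M : ℕ) :
    (1 / (blockLength M : ℝ)) • ∑ j, H ((freqIndex M j : ℝ) / (blockLength M : ℝ)) =
      ∫ x in (-(1 / 2) : ℝ)..(1 / 2),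
        H ((round ((blockLength M : ℝ) * x) : ℝ) / (blockLength M : ℝ)) := by
  have hN : (0 : ℝ) < (blockLength M : ℝ) := by positivity
  set N : ℝ := (blockLength M : ℝ) with hNdef
  set a : ℕ → ℝ := fun k => ((k : ℝ) - M - 1 / 2) / N with ha
  have hle : ∀ k, a k ≤ a (k + 1) := fun k => by
    simp only [ha]
    push_cast
    gcongr
    linarith
  have hcell : ∀ k : ℕ, Set.EqOn (fun _ => H (((k : ℝ) - M) / N))
      (fun x => H ((round (N * x) : ℝ) / N)) (Set.Ioo (a k) (a (k + 1))) := fun k x hx => by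
    have : round (N * x) = (k : ℤ) - M := by
      apply round_grid_eq hN
      simp only [ha] at hx
      push_cast at hx ⊢
      convert hx using 2
      ring
    simp [this]
  have hint : ∀ k < blockLength M, IntervalIntegrable (fun x => H ((round (N * x) : ℝ) / N))
      volume (a k) (a (k + 1)) := fun k _ => by
    rw [intervalIntegrable_iff_integrableOn_Ioo_of_le (hle k)]
    refine IntegrableOn.congr_fun ?_ (hcell k) measurableSet_Ioo
    exact integrableOn_const (by simp)
  have h0 : a 0 = -(1 / 2) := by
    simp only [ha, hNdef]
    push_cast
    field_simp
    ring
  have h1 : a (blockLength M) = 1 / 2 := by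
    simp only [ha, hNdef]
    push_cast
    field_simp
    ring
  rw [← h0, ← h1, ← intervalIntegral.sum_integral_adjacent_intervals hint, Finset.smul_sum,
    Finset.sum_range]
  refine Finset.sum_congr rfl fun j _ => ?_
  rw [← intervalIntegral.integral_congr_Ioo_of_le (hle j) (hcell j),
    intervalIntegral.integral_const]
  have : a (j + 1) - a j = 1 / N := by
    simp only [ha]
    push_cast
    ring
  rw [this]
  simp [freqIndex]

theorem tendsto_blockLength : Tendsto (fun M : ℕ => (blockLength M : ℝ)) atTop atTop := by
  refine tendsto_atTop_mono (fun M => ?_) (tendsto_natCast_atTop_atTop (R := ℝ))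
  push_cast
  linarith [(Nat.cast_nonneg M : (0 : ℝ) ≤ M)]

/-- Riemann sums of a bounded, almost everywhere continuous function converge to its integral. -/
theorem tendsto_riemannSum {E : Type*} [NormedAddCommGroup E] [NormedSpace ℝ E]
    [CompleteSpace E]
    {H : ℝ → E} {B : ℝ} (hB : ∀ x, ‖H x‖ ≤ B)
    (hcont : ∀ᵐ x : ℝ, ContinuousAt H x) :
    Tendsto (fun M : ℕ => (1 / (blockLength M : ℝ)) •
        ∑ j, H ((freqIndex M j : ℝ) / (blockLength M : ℝ))) atTop
      (𝓝 (∫ x in (-(1 / 2) : ℝ)..(1 / 2), H x)) := by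
  simp_rw [riemannSum_eq_integral_round]
  refine intervalIntegral.tendsto_integral_filter_of_dominated_convergence (fun _ => B) ?_ ?_ ?_ ?_
  · refine Eventually.of_forall fun M => ?_
    have hr : Measurable fun x : ℝ => round ((blockLength M : ℝ) * x) := by
      simp_rw [round_eq]
      exact Int.measurable_floor.comp (by fun_prop)
    have hs : StronglyMeasurable fun k : ℤ => H ((k : ℝ) / (blockLength M : ℝ)) :=
      StronglyMeasurable.of_discrete
    exact (hs.comp_measurable hr).aestronglyMeasurable
  · exact Eventually.of_forall fun M => Eventually.of_forall fun x _ => hB _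
  · exact intervalIntegrable_const
  · filter_upwards [hcont] with x hx _
    refine hx.tendsto.comp ?_
    rw [tendsto_iff_dist_tendsto_zero]
    have hz : Tendsto (fun M : ℕ => 1 / 2 / (blockLength M : ℝ)) atTop (𝓝 0) :=
      tendsto_const_nhds.div_atTop tendsto_blockLength
    refine squeeze_zero (fun _ => dist_nonneg) (fun M => ?_) hz
    have hN : (0 : ℝ) < (blockLength M : ℝ) := by positivity
    rw [Real.dist_eq, abs_sub_comm]
    have := abs_sub_round ((blockLength M : ℝ) * x)
    have h2 : x - (round ((blockLength M : ℝ) * x) : ℝ) / (blockLength M : ℝ) =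
        ((blockLength M : ℝ) * x - round ((blockLength M : ℝ) * x)) / (blockLength M : ℝ) := by
      field_simp
    rw [h2, abs_div, abs_of_pos hN]
    gcongr

/-- A function supported in `(-b, b)` and continuous there can only be discontinuous at `±b`. -/
theorem ae_continuousAt_of_band {E : Type*} [NormedAddCommGroup E] {H : ℝ → E} {b : ℝ}
    (hc : ContinuousOn H (Set.Ioo (-b) b)) (h0 : ∀ x, b ≤ |x| → H x = 0) :
    ∀ᵐ x : ℝ, ContinuousAt H x := by
  have : ∀ᵐ x : ℝ, x ∉ ({b, -b} : Set ℝ) :=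
    (Set.Finite.countable (by simp)).ae_notMem volume
  filter_upwards [this] with x hx
  by_cases h : |x| < b
  · exact hc.continuousAt (Ioo_mem_nhds (abs_lt.1 h).1 (abs_lt.1 h).2)
  · have hlt : b < |x| := by
      refine lt_of_le_of_ne (not_lt.1 h) fun hb => hx ?_
      rcases abs_cases x with h' | h'
      · exact Or.inl (by linarith)
      · exact Or.inr (by simp only [Set.mem_singleton_iff]; linarith)
    have hev : H =ᶠ[𝓝 x] fun _ => 0 := by
      filter_upwards [continuous_abs.continuousAt.eventually (lt_mem_nhds hlt)] with y hy
      exact h0 y hy.le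
    exact continuousAt_const.congr hev.symm

/-! ### Toeplitz matrices against circulant matrices -/

/-- In `ℓ²`, pointwise convergence together with convergence of the norms is convergence in norm.
By the parallelogram law `‖c - t‖² ≤ 2 ‖c‖² - 2 ‖t‖² + (4 ‖t‖² - ‖c + t‖²)⁺`, and the last term is
dominated by `4 ‖t‖²`. -/
theorem tendsto_tsum_norm_sub_sq {ι : Type*} {t : ι → ℂ} {c : ℕ → ι → ℂ}
    (ht : Summable fun k => ‖t k‖ ^ 2) (hc : ∀ M, Summable fun k => ‖c M k‖ ^ 2)
    (hlim : ∀ k, Tendsto (fun M => c M k) atTop (𝓝 (t k)))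
    (hnorm : Tendsto (fun M => ∑' k, ‖c M k‖ ^ 2) atTop (𝓝 (∑' k, ‖t k‖ ^ 2))) :
    (∀ M, Summable fun k => ‖c M k - t k‖ ^ 2) ∧
      Tendsto (fun M => ∑' k, ‖c M k - t k‖ ^ 2) atTop (𝓝 0) := by
  set f : ℕ → ι → ℝ := fun M k => max 0 (4 * ‖t k‖ ^ 2 - ‖c M k + t k‖ ^ 2) with hf
  have hf0 : ∀ M k, 0 ≤ f M k := fun M k => le_max_left _ _
  have hfle : ∀ M k, f M k ≤ 4 * ‖t k‖ ^ 2 := fun M k =>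
    max_le (by positivity) (by linarith [sq_nonneg ‖c M k + t k‖])
  have hfs : ∀ M, Summable (f M) := fun M =>
    (ht.mul_left 4).of_nonneg_of_le (hf0 M) (hfle M)
  have hbound : ∀ M k, ‖c M k - t k‖ ^ 2 ≤ 2 * ‖c M k‖ ^ 2 - 2 * ‖t k‖ ^ 2 + f M k := fun M k => by
    have h1 := parallelogram_law_with_norm ℝ (c M k) (t k)
    have h2 : 4 * ‖t k‖ ^ 2 - ‖c M k + t k‖ ^ 2 ≤ f M k := le_max_right _ _
    nlinarith
  have hsum : ∀ M, Summable fun k => 2 * ‖c M k‖ ^ 2 - 2 * ‖t k‖ ^ 2 + f M k := fun M =>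
    (((hc M).mul_left 2).sub (ht.mul_left 2)).add (hfs M)
  have hsub : ∀ M, Summable fun k => ‖c M k - t k‖ ^ 2 := fun M =>
    (hsum M).of_nonneg_of_le (fun k => by positivity) (hbound M)
  refine ⟨hsub, ?_⟩
  have hflim : Tendsto (fun M => ∑' k, f M k) atTop (𝓝 0) := by
    have := tendsto_tsum_of_dominated_convergence (f := f) (g := fun _ => (0 : ℝ))
      (𝓕 := atTop) (ht.mul_left 4) (fun k => ?_)
      (Eventually.of_forall fun M k => by
        rw [Real.norm_of_nonneg (hf0 M k)]; exact hfle M k)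
    · simpa using this
    · have h1 : Tendsto (fun M => max 0 (4 * ‖t k‖ ^ 2 - ‖c M k + t k‖ ^ 2)) atTop
          (𝓝 (max 0 (4 * ‖t k‖ ^ 2 - ‖t k + t k‖ ^ 2))) :=
        tendsto_const_nhds.max (tendsto_const_nhds.sub
          ((((hlim k).add tendsto_const_nhds).norm).pow 2))
      have h2 : ‖t k + t k‖ = 2 * ‖t k‖ := by rw [← two_mul, norm_mul]; simp
      rw [h2] at h1
      convert h1 using 2
      rw [eq_comm, max_eq_left]
      nlinarith
  have hmaj : Tendsto (fun M => 2 * ∑' k, ‖c M k‖ ^ 2 - 2 * ∑' k, ‖t k‖ ^ 2 + ∑' k, f M k)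
      atTop (𝓝 0) := by
    have := ((hnorm.const_mul 2).sub_const (2 * ∑' k, ‖t k‖ ^ 2)).add hflim
    simpa using this
  refine squeeze_zero (fun M => tsum_nonneg fun k => by positivity) (fun M => ?_) hmaj
  calc _ ≤ ∑' k, (2 * ‖c M k‖ ^ 2 - 2 * ‖t k‖ ^ 2 + f M k) :=
        (hsub M).tsum_le_tsum (hbound M) (hsum M)
    _ = _ := by
      rw [Summable.tsum_add (((hc M).mul_left 2).sub (ht.mul_left 2)) (hfs M),
        Summable.tsum_sub ((hc M).mul_left 2) (ht.mul_left 2), tsum_mul_left, tsum_mul_left]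

/-- The representative in `{-M, …, M}`, modulo `2M + 1`, of an integer `k` with `|k| ≤ 2M`. -/
def balancedRep (M : ℕ) (k : ℤ) : ℤ :=
  if (M : ℤ) < k then k - (2 * M + 1) else if k < -M then k + (2 * M + 1) else k

theorem sum_freqIndex {E : Type*} [AddCommMonoid E] (M : ℕ) (f : ℤ → E) :
    ∑ j, f (freqIndex M j) = ∑ k ∈ Finset.Icc (-(M : ℤ)) M, f k := by
  refine Finset.sum_bij (fun j _ => freqIndex M j) ?_ ?_ ?_ ?_
  · intro j _
    have := j.isLt
    simp only [freqIndex, Finset.mem_Icc, blockLength] at *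
    omega
  · intro i _ j _ h
    simp only [freqIndex] at h
    exact Fin.ext (by omega)
  · intro k hk
    rw [Finset.mem_Icc] at hk
    refine ⟨⟨(k + M).toNat, by simp only [blockLength]; omega⟩, Finset.mem_univ _, ?_⟩
    simp only [freqIndex]
    omega
  · intro _ _
    rfl

/-- Among the pairs whose difference wraps around, a residue `l` occurs at most `|l|` times: `n`
determines `m`, and lies in a window of length `|l|` at one end of the block. -/
theorem card_wrapped_le (M : ℕ) (l : ℤ) :
    ((Finset.univ.filter fun q : Fin (blockLength M) × Fin (blockLength M) =>
      (M : ℤ) < |(q.1 : ℤ) - q.2| ∧ balancedRep M ((q.1 : ℤ) - q.2) = l).card : ℝ) ≤ |(l : ℝ)| := by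
  have key : (Finset.univ.filter fun q : Fin (blockLength M) × Fin (blockLength M) =>
      (M : ℤ) < |(q.1 : ℤ) - q.2| ∧ balancedRep M ((q.1 : ℤ) - q.2) = l).card ≤ l.natAbs := by
    have hcard : (if 0 ≤ l then Finset.Ico 0 l else
        Finset.Ico (2 * M + 1 + l) (2 * M + 1 : ℤ)).card = l.natAbs := by
      split_ifs
      · rw [Int.card_Ico]; omega
      · rw [Int.card_Ico]; omega
    rw [← hcard]
    refine Finset.card_le_card_of_injOn (fun q => (q.1 : ℤ)) ?_ ?_
    · rintro ⟨n, m⟩ hq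
      have hn := n.isLt
      have hm := m.isLt
      simp only [Finset.coe_filter, Finset.mem_univ, true_and, Set.mem_ofPred_eq, balancedRep,
        blockLength, lt_abs] at hq hn hm
      obtain ⟨h1, h2⟩ := hq
      simp only [SetLike.mem_coe]
      split_ifs with h3
      · rw [Finset.mem_Ico]
        split_ifs at h2 <;> omega
      · rw [Finset.mem_Ico]
        split_ifs at h2 <;> omega
    · rintro ⟨n, m⟩ hq ⟨n', m'⟩ hq' h
      have hn := n.isLt
      have hm := m.isLt
      have hn' := n'.isLt
      have hm' := m'.isLt
      simp only [Finset.coe_filter, Finset.mem_univ, true_and, Set.mem_ofPred_eq, balancedRep,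
        blockLength, lt_abs] at hq hq' hn hm hn' hm' h
      obtain ⟨h1, h2⟩ := hq
      obtain ⟨h1', h2'⟩ := hq'
      have e1 : n = n' := Fin.ext (by omega)
      have e2 : m = m' := Fin.ext (by
        split_ifs at h2 h2' <;> omega)
      rw [e1, e2]
  calc _ ≤ ((l.natAbs : ℕ) : ℝ) := by exact_mod_cast key
    _ = |(l : ℝ)| := by rw [Nat.cast_natAbs]; simp

theorem balancedRep_mem (M : ℕ) (n m : Fin (blockLength M)) :
    balancedRep M ((n : ℤ) - m) ∈ Finset.Icc (-(M : ℤ)) M := by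
  have hn := n.isLt
  have hm := m.isLt
  simp only [blockLength] at hn hm
  simp only [balancedRep, Finset.mem_Icc]
  split_ifs <;> omega

theorem balancedRep_of_abs_le {M : ℕ} {k : ℤ} (hk : |k| ≤ M) : balancedRep M k = k := by
  rw [abs_le] at hk
  simp only [balancedRep]
  split_ifs <;> omega

/-- A row visits each value of `e` at most once, so its sum is bounded by the sum over `ℤ`. -/
theorem sum_row_le {M : ℕ} {f : ℤ → ℝ} (hf : Summable f) (h0 : ∀ k, 0 ≤ f k)
    (n : Fin (blockLength M)) {e : ℤ → ℤ}
    (he : ∀ m m' : Fin (blockLength M), e ((n : ℤ) - m) = e ((n : ℤ) - m') → m = m') :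
    ∑ m : Fin (blockLength M), f (e ((n : ℤ) - m)) ≤ ∑' k, f k := by
  have hinj : Function.Injective fun m : Fin (blockLength M) => e ((n : ℤ) - m) :=
    fun m m' h => he m m' h
  rw [← tsum_fintype (L := SummationFilter.unconditional _)]
  exact tsum_comp_le_tsum_of_inj hf h0 hinj

/-- If the `2M + 1`-periodic sequences `c M` converge to `t ∈ ℓ²` pointwise and in energy, then the
circulant matrices of the `c M` and the Toeplitz matrices of `t` have Frobenius distance
`o(√N)`. Entries with `|n - m| > M` wrap around; a residue `l` does so in only `|l|` rows, which is
negligible on average because `∑ |t l|² |l| / N → 0`. -/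
theorem tendsto_toeplitz_sub_circulant {t : ℤ → ℂ} {c : ℕ → ℤ → ℂ}
    (ht : Summable fun k => ‖t k‖ ^ 2)
    (hper : ∀ M : ℕ, ∀ k, c M (k + (2 * M + 1)) = c M k)
    (hlim : ∀ k, Tendsto (fun M => c M k) atTop (𝓝 (t k)))
    (hnorm : Tendsto (fun M => ∑ j, ‖c M (freqIndex M j)‖ ^ 2) atTop (𝓝 (∑' k, ‖t k‖ ^ 2))) :
    Tendsto (fun M : ℕ => 1 / (blockLength M : ℝ) *
      ∑ n : Fin (blockLength M), ∑ m : Fin (blockLength M),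
        ‖t ((n : ℤ) - m) - c M ((n : ℤ) - m)‖ ^ 2) atTop (𝓝 0) := by
  set d : ℕ → ℤ → ℂ := fun M k => if k ∈ Finset.Icc (-(M : ℤ)) M then c M k else 0 with hd
  have hd0 : ∀ (M : ℕ) (k : ℤ), k ∉ Finset.Icc (-(M : ℤ)) M → ‖d M k‖ ^ 2 = 0 := fun M k hk => by
    simp only [hd, if_neg hk]; simp
  have hdt : ∀ M, ∑' k, ‖d M k‖ ^ 2 = ∑ j, ‖c M (freqIndex M j)‖ ^ 2 := fun M => by
    rw [sum_freqIndex M fun k => ‖c M k‖ ^ 2, tsum_eq_sum (hd0 M)]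
    exact Finset.sum_congr rfl fun k hk => by simp only [hd, if_pos hk]
  have hmem : ∀ k : ℤ, ∀ᶠ M : ℕ in atTop, k ∈ Finset.Icc (-(M : ℤ)) M := fun k => by
    filter_upwards [eventually_ge_atTop k.natAbs] with M hM
    rw [Finset.mem_Icc]; omega
  obtain ⟨hE, hElim⟩ := tendsto_tsum_norm_sub_sq (c := d) ht
    (fun M => summable_of_ne_finset_zero (hd0 M))
    (fun k => (hlim k).congr' (by
      filter_upwards [hmem k] with M hM
      simp only [hd, if_pos hM]))
    (by simpa only [hdt] using hnorm)
  set E : ℕ → ℝ := fun M => ∑' k, ‖d M k - t k‖ ^ 2 with hEdef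
  have hW : Tendsto (fun M : ℕ => ∑ l ∈ Finset.Icc (-(M : ℤ)) M,
      |(l : ℝ)| / (blockLength M : ℝ) * ‖t l‖ ^ 2) atTop (𝓝 0) := by
    have := tendsto_tsum_of_dominated_convergence (𝓕 := atTop)
      (f := fun (M : ℕ) (l : ℤ) => if l ∈ Finset.Icc (-(M : ℤ)) M then
        |(l : ℝ)| / (blockLength M : ℝ) * ‖t l‖ ^ 2 else 0) (g := fun _ => (0 : ℝ)) ht
      (fun l => ?_) (Eventually.of_forall fun M l => ?_)
    · rw [tsum_zero] at this
      refine this.congr fun M => ?_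
      rw [tsum_eq_sum (s := Finset.Icc (-(M : ℤ)) M) fun l hl => if_neg hl]
      exact Finset.sum_congr rfl fun l hl => if_pos hl
    · have h1 : Tendsto (fun M : ℕ => |(l : ℝ)| / (blockLength M : ℝ) * ‖t l‖ ^ 2) atTop
          (𝓝 (0 * ‖t l‖ ^ 2)) := by
        refine (tendsto_const_nhds.div_atTop ?_).mul_const _
        refine tendsto_atTop_mono (fun M => ?_) (tendsto_natCast_atTop_atTop (R := ℝ))
        push_cast
        linarith [(Nat.cast_nonneg M : (0 : ℝ) ≤ M)]
      rw [zero_mul] at h1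
      refine h1.congr' ?_
      filter_upwards [hmem l] with M hM
      rw [if_pos hM]
    · split_ifs with hl
      · rw [Real.norm_of_nonneg (by positivity)]
        refine mul_le_of_le_one_left (by positivity) ?_
        rw [div_le_one (by positivity)]
        rw [Finset.mem_Icc] at hl
        have : |l| ≤ (2 * M + 1 : ℤ) := abs_le.2 ⟨by omega, by omega⟩
        push_cast
        exact_mod_cast this
      · simp
  have hmaj : Tendsto (fun M : ℕ => 6 * E M + 4 * ∑ l ∈ Finset.Icc (-(M : ℤ)) M,
      |(l : ℝ)| / (blockLength M : ℝ) * ‖t l‖ ^ 2) atTop (𝓝 0) := by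
    simpa using (hElim.const_mul 6).add (hW.const_mul 4)
  refine squeeze_zero (fun M => by positivity) (fun M => ?_) hmaj
  have hN : (0 : ℝ) < (blockLength M : ℝ) := by positivity
  -- a wrapped entry is compared with `t` at the representative of its residue
  have hentry : ∀ n m : Fin (blockLength M),
      ‖t ((n : ℤ) - m) - c M ((n : ℤ) - m)‖ ^ 2 ≤
        4 * ‖d M (balancedRep M ((n : ℤ) - m)) - t (balancedRep M ((n : ℤ) - m))‖ ^ 2 +
        2 * ‖d M ((n : ℤ) - m) - t ((n : ℤ) - m)‖ ^ 2 +
        4 * (if (M : ℤ) < |(n : ℤ) - m| then ‖t (balancedRep M ((n : ℤ) - m))‖ ^ 2 else 0) := by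
    intro n m
    have hdc : d M (balancedRep M ((n : ℤ) - m)) = c M ((n : ℤ) - m) := by
      simp only [hd, if_pos (balancedRep_mem M n m)]
      simp only [balancedRep]
      split_ifs
      · rw [← hper M]; congr 1; ring
      · exact hper M _
      · rfl
    by_cases h : (M : ℤ) < |(n : ℤ) - m|
    · have hdz : d M ((n : ℤ) - m) = 0 := by
        simp only [hd]
        rw [if_neg]
        rw [Finset.mem_Icc, ← abs_le]
        exact not_le.2 h
      rw [if_pos h, hdz, hdc, zero_sub, norm_neg]
      set u := t ((n : ℤ) - m)
      set v := c M ((n : ℤ) - m)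
      set w := t (balancedRep M ((n : ℤ) - m))
      have h1 : ‖u - v‖ ≤ ‖u‖ + ‖v‖ := norm_sub_le _ _
      have h2 : ‖v‖ ≤ ‖v - w‖ + ‖w‖ := by simpa using norm_add_le (v - w) w
      have h3 : ‖u - v‖ ≤ ‖u‖ + (‖v - w‖ + ‖w‖) := by linarith
      calc ‖u - v‖ ^ 2 ≤ (‖u‖ + (‖v - w‖ + ‖w‖)) ^ 2 := by gcongr
        _ ≤ _ := by
          nlinarith [sq_nonneg (‖u‖ - (‖v - w‖ + ‖w‖)), sq_nonneg (‖v - w‖ - ‖w‖)]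
    · have hb := balancedRep_of_abs_le (not_lt.1 h)
      rw [if_neg h, hb]
      rw [hb] at hdc
      rw [hdc, norm_sub_rev]
      nlinarith [sq_nonneg ‖c M ((n : ℤ) - m) - t ((n : ℤ) - m)‖]
  have hrow1 : ∀ n : Fin (blockLength M), ∑ m : Fin (blockLength M),
      ‖d M (balancedRep M ((n : ℤ) - m)) - t (balancedRep M ((n : ℤ) - m))‖ ^ 2 ≤ E M :=
    fun n => sum_row_le (e := balancedRep M) (hE M) (fun k => by positivity) n fun m m' h => by
      have hn := n.isLt
      have hm := m.isLt
      have hm' := m'.isLt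
      simp only [blockLength, balancedRep] at hn hm hm' h
      refine Fin.ext ?_
      split_ifs at h <;> omega
  have hrow2 : ∀ n : Fin (blockLength M), ∑ m : Fin (blockLength M),
      ‖d M ((n : ℤ) - m) - t ((n : ℤ) - m)‖ ^ 2 ≤ E M :=
    fun n => sum_row_le (e := id) (hE M) (fun k => by positivity) n fun m m' h =>
      Fin.ext (by simp only [id] at h; omega)
  have hwrap : ∑ n : Fin (blockLength M), ∑ m : Fin (blockLength M),
      (if (M : ℤ) < |(n : ℤ) - m| then ‖t (balancedRep M ((n : ℤ) - m))‖ ^ 2 else 0) ≤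
        ∑ l ∈ Finset.Icc (-(M : ℤ)) M, |(l : ℝ)| * ‖t l‖ ^ 2 := by
    rw [← Fintype.sum_prod_type' (f := fun n m : Fin (blockLength M) =>
      (if (M : ℤ) < |(n : ℤ) - m| then ‖t (balancedRep M ((n : ℤ) - m))‖ ^ 2 else 0)),
      ← Finset.sum_filter]
    rw [← Finset.sum_fiberwise_of_maps_to
      (g := fun q : Fin (blockLength M) × Fin (blockLength M) => balancedRep M ((q.1 : ℤ) - q.2))
      (t := Finset.Icc (-(M : ℤ)) M) fun q _ => balancedRep_mem M q.1 q.2]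
    refine Finset.sum_le_sum fun l _ => ?_
    rw [Finset.filter_filter]
    calc _ = ∑ q : Fin (blockLength M) × Fin (blockLength M) with
            (M : ℤ) < |(q.1 : ℤ) - q.2| ∧ balancedRep M ((q.1 : ℤ) - q.2) = l, ‖t l‖ ^ 2 :=
          Finset.sum_congr rfl fun q hq => by rw [(Finset.mem_filter.1 hq).2.2]
      _ ≤ _ := by
        rw [Finset.sum_const, nsmul_eq_mul]
        exact mul_le_mul_of_nonneg_right (card_wrapped_le M l) (by positivity)
  calc _ ≤ 1 / (blockLength M : ℝ) * (4 * ((blockLength M : ℝ) * E M) +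
          2 * ((blockLength M : ℝ) * E M) +
          4 * ∑ l ∈ Finset.Icc (-(M : ℤ)) M, |(l : ℝ)| * ‖t l‖ ^ 2) := by
        refine mul_le_mul_of_nonneg_left ?_ (by positivity)
        refine (Finset.sum_le_sum fun n _ => Finset.sum_le_sum fun m _ => hentry n m).trans ?_
        simp only [Finset.sum_add_distrib, ← Finset.mul_sum]
        have c1 := Finset.sum_le_sum fun n (_ : n ∈ Finset.univ) => hrow1 n
        have c2 := Finset.sum_le_sum fun n (_ : n ∈ Finset.univ) => hrow2 n
        rw [Finset.sum_const, Finset.card_univ, Fintype.card_fin, nsmul_eq_mul] at c1 c2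
        linarith
    _ = _ := by
      simp_rw [div_mul_eq_mul_div, ← Finset.sum_div]
      field_simp
      ring

/-! ### The discrete Fourier transform -/

theorem dftMatrix_star_mul (M : ℕ) (n m j : Fin (blockLength M)) :
    dftMatrix M n j * star (dftMatrix M m j) =
      (1 / (blockLength M : ℂ)) * Complex.exp (-2 * Real.pi * Complex.I * (((n : ℤ) - m : ℤ) : ℂ) *
        (freqIndex M j : ℂ) / (blockLength M : ℂ)) := by
  have hN : (0 : ℝ) < (blockLength M : ℝ) := by positivity
  have hs : ((1 / Real.sqrt (blockLength M) : ℝ) : ℂ) * ((1 / Real.sqrt (blockLength M) : ℝ) : ℂ) =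
      1 / (blockLength M : ℂ) := by
    rw [← Complex.ofReal_mul, div_mul_div_comm, Real.mul_self_sqrt hN.le]
    push_cast
    ring
  simp only [dftMatrix, Matrix.of_apply, star_mul', Complex.star_def, Complex.conj_ofReal,
    ← Complex.exp_conj]
  rw [mul_mul_mul_comm, hs, ← Complex.exp_add]
  congr 2
  simp only [map_div₀, map_mul, map_neg, Complex.conj_ofReal, Complex.conj_I, map_natCast,
    map_intCast, map_ofNat]
  push_cast
  ring

theorem dftMatrix_conjTranspose_mul_self (M : ℕ) : (dftMatrix M)ᴴ * dftMatrix M = 1 := by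
  have hN : (0 : ℝ) < (blockLength M : ℝ) := by positivity
  have hNC : (blockLength M : ℂ) ≠ 0 := by exact_mod_cast hN.ne'
  have hs : ((1 / Real.sqrt (blockLength M) : ℝ) : ℂ) * ((1 / Real.sqrt (blockLength M) : ℝ) : ℂ) =
      1 / (blockLength M : ℂ) := by
    rw [← Complex.ofReal_mul, div_mul_div_comm, Real.mul_self_sqrt hN.le]
    push_cast
    ring
  ext i j
  set z : ℂ := Complex.exp (2 * Real.pi * Complex.I * (((i : ℤ) - j : ℤ) : ℂ) /
    (blockLength M : ℂ)) with hz
  have hterm : ∀ m : Fin (blockLength M), star (dftMatrix M m i) * dftMatrix M m j =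
      1 / (blockLength M : ℂ) * z ^ (m : ℕ) := fun m => by
    simp only [dftMatrix, Matrix.of_apply, star_mul', Complex.star_def, Complex.conj_ofReal,
      ← Complex.exp_conj]
    rw [mul_mul_mul_comm, hs, ← Complex.exp_add, hz, ← Complex.exp_nat_mul]
    congr 2
    simp only [map_div₀, map_mul, map_neg, Complex.conj_ofReal, Complex.conj_I, map_natCast,
      map_intCast, map_ofNat, freqIndex]
    push_cast
    ring
  rw [Matrix.mul_apply]
  simp only [Matrix.conjTranspose_apply]
  simp_rw [hterm]
  rw [← Finset.mul_sum, ← Finset.sum_range fun m => z ^ m]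
  by_cases hij : i = j
  · have : z = 1 := by rw [hz, hij]; simp
    rw [this, hij, Matrix.one_apply_eq]
    simp only [one_pow, Finset.sum_const, Finset.card_range, nsmul_eq_mul, mul_one]
    exact one_div_mul_cancel hNC
  · rw [Matrix.one_apply_ne hij]
    have hz1 : z ≠ 1 := by
      intro h
      rw [hz, Complex.exp_eq_one_iff] at h
      obtain ⟨k, hk⟩ := h
      have hpi : (2 * Real.pi * Complex.I : ℂ) ≠ 0 := Complex.two_pi_I_ne_zero
      rw [div_eq_iff hNC, mul_comm (k : ℂ), mul_assoc _ (k : ℂ)] at hk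
      have h2 := mul_left_cancel₀ hpi hk
      have h3 : ((i : ℤ) - j : ℤ) = k * (blockLength M : ℤ) := by exact_mod_cast h2
      have hi := i.isLt
      have hj := j.isLt
      apply hij
      have : k = 0 := by
        have habs : |(i : ℤ) - j| < (blockLength M : ℤ) := abs_lt.2 ⟨by omega, by omega⟩
        rw [h3, abs_mul, abs_of_pos (by exact_mod_cast hN : (0 : ℤ) < (blockLength M : ℤ))] at habs
        have h4 : |k| < 1 := by
          by_contra hk1
          have : (blockLength M : ℤ) ≤ |k| * (blockLength M : ℤ) :=
            le_mul_of_one_le_left (by positivity) (not_lt.1 hk1)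
          omega
        exact Int.abs_lt_one_iff.1 h4
      rw [this, zero_mul] at h3
      exact Fin.ext (by omega)
    have hzN : z ^ blockLength M = 1 := by
      rw [hz, ← Complex.exp_nat_mul, mul_div_cancel₀ _ hNC, Complex.exp_eq_one_iff]
      exact ⟨(i : ℤ) - j, by push_cast; ring⟩
    rw [geom_sum_eq hz1, hzN]
    simp

theorem sum_norm_dftMatrix_mulVec_sq (M : ℕ) (v : Fin (blockLength M) → ℂ) :
    ∑ j, ‖(dftMatrix M *ᵥ v) j‖ ^ 2 = ∑ j, ‖v j‖ ^ 2 := by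
  have h : ∀ u : Fin (blockLength M) → ℂ, ((∑ j, ‖u j‖ ^ 2 : ℝ) : ℂ) = star u ⬝ᵥ u := fun u => by
    simp only [dotProduct, Pi.star_apply, Complex.star_def, Complex.conj_mul']
    push_cast
    rfl
  have : star (dftMatrix M *ᵥ v) ⬝ᵥ (dftMatrix M *ᵥ v) = star v ⬝ᵥ v := by
    rw [Matrix.star_mulVec, Matrix.dotProduct_mulVec, Matrix.vecMul_vecMul,
      dftMatrix_conjTranspose_mul_self, Matrix.vecMul_one]
  exact_mod_cast (h _).trans (this.trans (h v).symm)

/-- The `k`-th discrete Fourier coefficient of the samples `F (i / N)`, `|i| ≤ M`. -/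
noncomputable def sampledCoeff (F : ℝ → ℝ) (M : ℕ) (k : ℤ) : ℂ :=
  (1 / (blockLength M : ℝ)) • ∑ j, (F ((freqIndex M j : ℝ) / (blockLength M : ℝ)) : ℂ) *
    Complex.exp (-2 * Real.pi * Complex.I * (k : ℂ) *
      (((freqIndex M j : ℝ) / (blockLength M : ℝ) : ℝ) : ℂ))

theorem dft_diagonal_apply (F : ℝ → ℝ) (M : ℕ) (n m : Fin (blockLength M)) :
    (dftMatrix M * Matrix.diagonal
        (fun j => (F ((freqIndex M j : ℝ) / (blockLength M : ℝ)) : ℂ)) * (dftMatrix M)ᴴ) n m =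
      sampledCoeff F M ((n : ℤ) - m) := by
  rw [Matrix.mul_apply, sampledCoeff, Finset.smul_sum]
  refine Finset.sum_congr rfl fun j _ => ?_
  rw [Matrix.mul_diagonal, Matrix.conjTranspose_apply, mul_right_comm, dftMatrix_star_mul,
    Complex.real_smul]
  push_cast
  rw [mul_right_comm, mul_assoc, ← mul_div_assoc]

theorem sampledCoeff_periodic (F : ℝ → ℝ) (M : ℕ) (k : ℤ) :
    sampledCoeff F M (k + (2 * M + 1)) = sampledCoeff F M k := by
  have hN : (0 : ℝ) < (blockLength M : ℝ) := by positivity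
  have hNC : (blockLength M : ℂ) ≠ 0 := by exact_mod_cast hN.ne'
  unfold sampledCoeff
  congr 1
  refine Finset.sum_congr rfl fun j _ => ?_
  congr 1
  rw [Complex.exp_eq_exp_iff_exists_int]
  refine ⟨-freqIndex M j, ?_⟩
  have : (((2 * M + 1 : ℤ)) : ℂ) = (blockLength M : ℂ) := by push_cast; ring
  rw [Int.cast_add, this]
  push_cast at hNC ⊢
  field_simp
  ring

theorem sum_norm_sampledCoeff_sq (F : ℝ → ℝ) (M : ℕ) :
    ∑ j, ‖sampledCoeff F M (freqIndex M j)‖ ^ 2 =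
      (1 / (blockLength M : ℝ)) • ∑ j, F ((freqIndex M j : ℝ) / (blockLength M : ℝ)) ^ 2 := by
  have hN : (0 : ℝ) < (blockLength M : ℝ) := by positivity
  -- row `l = j - M` of the transform is row `j` of the DFT matrix after a modulation of the data
  set v : Fin (blockLength M) → ℂ := fun i =>
    (F ((freqIndex M i : ℝ) / (blockLength M : ℝ)) : ℂ) *
      Complex.exp (((2 * Real.pi * M * (freqIndex M i : ℝ) / (blockLength M : ℝ) : ℝ) : ℂ) *
        Complex.I) with hv
  have hvn : ∀ i, ‖v i‖ ^ 2 = F ((freqIndex M i : ℝ) / (blockLength M : ℝ)) ^ 2 := fun i => by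
    simp only [hv]
    rw [norm_mul, Complex.norm_exp_ofReal_mul_I, mul_one, Complex.norm_real, Real.norm_eq_abs,
      sq_abs]
  have hc : ∀ j, sampledCoeff F M (freqIndex M j) =
      ((1 / Real.sqrt (blockLength M) : ℝ) : ℂ) * (dftMatrix M *ᵥ v) j := fun j => by
    have hs : ((1 / (blockLength M : ℝ) : ℝ) : ℂ) = ((1 / Real.sqrt (blockLength M) : ℝ) : ℂ) *
        ((1 / Real.sqrt (blockLength M) : ℝ) : ℂ) := by
      rw [← Complex.ofReal_mul, div_mul_div_comm, Real.mul_self_sqrt hN.le, one_mul]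
    rw [sampledCoeff, Complex.real_smul, hs, mul_assoc, Matrix.mulVec, dotProduct, Finset.mul_sum]
    congr 1
    refine Finset.sum_congr rfl fun i _ => ?_
    simp only [dftMatrix, Matrix.of_apply, hv]
    have e : Complex.exp (-2 * Real.pi * Complex.I * (freqIndex M j : ℂ) *
        (((freqIndex M i : ℝ) / (blockLength M : ℝ) : ℝ) : ℂ)) =
        Complex.exp (-2 * Real.pi * Complex.I * ((j : ℕ) : ℂ) * (freqIndex M i : ℂ) /
          (blockLength M : ℂ)) *
        Complex.exp (((2 * Real.pi * M * (freqIndex M i : ℝ) / (blockLength M : ℝ) : ℝ) : ℂ) *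
        Complex.I) := by
      rw [← Complex.exp_add]
      congr 1
      simp only [freqIndex]
      push_cast
      ring
    rw [e]
    ring
  simp_rw [hc, norm_mul, mul_pow]
  rw [← Finset.mul_sum, sum_norm_dftMatrix_mulVec_sq]
  simp_rw [hvn]
  rw [Complex.norm_real, Real.norm_eq_abs, sq_abs, div_pow, Real.sq_sqrt hN.le, one_pow,
    smul_eq_mul]

/-! ### The sampled spectrum against its Fourier coefficients -/

/-- The circulant matrices of the samples of `F` and the Toeplitz matrices of its Fourier
coefficients are asymptotically equivalent. Riemann sums give convergence of the coefficients and,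
with Parseval's identity for the continuous and the discrete transform, of their energy. -/
theorem tendsto_toeplitz_sub_dft {F : ℝ → ℝ} {t : ℤ → ℂ} {B b : ℝ}
    (hB : ∀ x, |F x| ≤ B) (hcont : ContinuousOn F (Set.Ioo (-b) b)) (h0 : ∀ x, b ≤ |x| → F x = 0)
    (hmeas : Measurable F)
    (ht : ∀ k : ℤ, t k = ∫ x in (-(1 / 2) : ℝ)..(1 / 2),
      (F x : ℂ) * Complex.exp (-2 * Real.pi * Complex.I * (k : ℂ) * (x : ℂ))) :
    Tendsto (fun M : ℕ => 1 / (blockLength M : ℝ) *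
      ∑ n : Fin (blockLength M), ∑ m : Fin (blockLength M),
        ‖t ((n : ℤ) - m) - sampledCoeff F M ((n : ℤ) - m)‖ ^ 2) atTop (𝓝 0) := by
  have hexp : ∀ (k : ℤ) (x : ℝ),
      ‖Complex.exp (-2 * Real.pi * Complex.I * (k : ℂ) * (x : ℂ))‖ = 1 := fun k x => by
    have : (-2 * Real.pi * Complex.I * (k : ℂ) * (x : ℂ)) =
        ((-2 * Real.pi * k * x : ℝ) : ℂ) * Complex.I := by push_cast; ring
    rw [this, Complex.norm_exp_ofReal_mul_I]
  have hab : (-(1 / 2) : ℝ) < 1 / 2 := by norm_num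
  have hF2 : MemLp (fun x => (F x : ℂ)) 2 (volume.restrict (Set.Ioc (-(1 / 2) : ℝ) (1 / 2))) := by
    refine MemLp.of_bound (by fun_prop) B (Eventually.of_forall fun x => ?_)
    rw [Complex.norm_real]
    exact hB x
  have hpars := hasSum_sq_fourierCoeffOn hab hF2
  have hcoef : ∀ k, fourierCoeffOn hab (fun x => (F x : ℂ)) k = t k := fun k => by
    rw [fourierCoeffOn_eq_integral, ht]
    have : (1 / (1 / 2 - -(1 / 2)) : ℝ) = 1 := by norm_num
    rw [this, one_smul]
    refine intervalIntegral.integral_congr fun x _ => ?_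
    simp only [fourier_coe_apply, smul_eq_mul]
    rw [mul_comm]
    congr 2
    push_cast
    ring
  simp_rw [hcoef] at hpars
  have hone : (1 / 2 - -(1 / 2) : ℝ)⁻¹ = 1 := by norm_num
  rw [hone, one_smul] at hpars
  refine tendsto_toeplitz_sub_circulant hpars.summable (sampledCoeff_periodic F) (fun k => ?_) ?_
  · rw [ht]
    refine tendsto_riemannSum
      (H := fun x : ℝ => (F x : ℂ) * Complex.exp (-2 * Real.pi * Complex.I * (k : ℂ) * (x : ℂ)))
      (B := B) (fun x => ?_) (ae_continuousAt_of_band (b := b) ?_ fun x hx => ?_)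
    · rw [norm_mul, hexp, mul_one, Complex.norm_real]
      exact hB x
    · exact (Complex.continuous_ofReal.comp_continuousOn hcont).mul
        (Continuous.continuousOn (by fun_prop))
    · simp [h0 x hx]
  · simp_rw [sum_norm_sampledCoeff_sq]
    rw [hpars.tsum_eq]
    have := tendsto_riemannSum (H := fun x : ℝ => F x ^ 2) (B := B ^ 2) (fun x => ?_)
      (ae_continuousAt_of_band (b := b) (hcont.pow 2) fun x hx => by simp [h0 x hx])
    · simpa using this
    · rw [norm_pow]
      exact pow_le_pow_left₀ (norm_nonneg _) (hB x) 2

/-! ### The folded spectrum of a pulse faster than Nyquist -/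

/-- One period of the generating function, `G (f / δT) / δT`: when `δ (1 + β) < 1` the shifted
copies of the spectrum do not overlap, and this is the folded spectrum on `[-1/2, 1/2]`. -/
noncomputable def scaledSpectrum (G : ℝ → ℝ) (δ T f : ℝ) : ℝ := 1 / (δ * T) * G (f / (δ * T))

/-- The received power spectrum under the optimal input: `P T / (1 + β)` in the band. -/
noncomputable def flatSpectrum (T β δ P f : ℝ) : ℝ :=
  if |f| < δ * (1 + β) / 2 then P * T / (1 + β) else 0

section Spectrum

variable {p G : ℝ → ℝ} {T β δ P : ℝ}

theorem IsPulseSpectrum.ne_zero_iff (hG : IsPulseSpectrum p T β G) (hT : 0 < T) (hδ : 0 < δ)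
    (f : ℝ) : G (f / (δ * T)) ≠ 0 ↔ |f| < δ * (1 + β) / 2 := by
  rw [hG.band, abs_div, abs_of_pos (mul_pos hδ hT), div_lt_iff₀ (mul_pos hδ hT)]
  have : (1 + β) / (2 * T) * (δ * T) = δ * (1 + β) / 2 := by field_simp
  rw [this]

theorem half_band_lt (hβ : 0 ≤ β) (hδβ : δ < 1 / (1 + β)) : δ * (1 + β) / 2 < 1 / 2 := by
  rw [lt_div_iff₀ (by linarith)] at hδβ
  linarith

theorem IsPulseSpectrum.foldedSpectrum_eq (hG : IsPulseSpectrum p T β G) (hT : 0 < T)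
    (hβ : 0 ≤ β) (hδ : 0 < δ) (hδβ : δ < 1 / (1 + β)) {f : ℝ} (hf : |f| ≤ 1 / 2) :
    foldedSpectrum G δ T f = scaledSpectrum G δ T f := by
  rw [foldedSpectrum, scaledSpectrum, tsum_eq_single (0 : ℤ)]
  · simp
  · intro m hm
    by_contra h
    rw [← Ne, hG.ne_zero_iff hT hδ] at h
    have h1 := half_band_lt hβ hδβ
    have h2 : (1 : ℝ) ≤ |(m : ℝ)| := by exact_mod_cast Int.one_le_abs hm
    have h3 : |(m : ℝ)| ≤ |f| + |f - m| := by
      have := abs_sub f (f - m)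
      simpa using this
    linarith

theorem IsPulseSpectrum.scaledSpectrum_nonneg (hG : IsPulseSpectrum p T β G) (hT : 0 < T)
    (hδ : 0 < δ) (f : ℝ) : 0 ≤ scaledSpectrum G δ T f :=
  mul_nonneg (by positivity) (hG.nonneg _)

theorem IsPulseSpectrum.scaledSpectrum_eq_zero (hG : IsPulseSpectrum p T β G) (hT : 0 < T)
    (hδ : 0 < δ) {f : ℝ} (hf : δ * (1 + β) / 2 ≤ |f|) : scaledSpectrum G δ T f = 0 := by
  have : G (f / (δ * T)) = 0 := by
    by_contra h
    exact absurd ((hG.ne_zero_iff hT hδ f).1 h) (not_lt.2 hf)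
  rw [scaledSpectrum, this, mul_zero]

theorem IsPulseSpectrum.continuousOn_scaledSpectrum (hG : IsPulseSpectrum p T β G) (hT : 0 < T)
    (hδ : 0 < δ) : ContinuousOn (scaledSpectrum G δ T)
      (Set.Ioo (-(δ * (1 + β) / 2)) (δ * (1 + β) / 2)) := by
  refine continuousOn_const.mul (hG.continuousOn.comp (by fun_prop) fun f hf => ?_)
  exact abs_lt.1 ((hG.band _).1 ((hG.ne_zero_iff hT hδ f).2 (abs_lt.2 hf)))

theorem IsPulseSpectrum.measurable (hG : IsPulseSpectrum p T β G) : Measurable G := by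
  classical
  have h := hG.continuousOn.measurable_piecewise (g := fun _ => (0 : ℝ)) continuousOn_const
    measurableSet_Ioo
  convert h using 1
  funext f
  by_cases hf : f ∈ Set.Ioo (-((1 + β) / (2 * T))) ((1 + β) / (2 * T))
  · rw [Set.piecewise_eq_of_mem _ _ _ hf]
  · rw [Set.piecewise_eq_of_notMem _ _ _ hf]
    by_contra h0
    exact hf (abs_lt.1 ((hG.band f).1 h0))

theorem matchedResponse_neg (p : ℝ → ℝ) (t : ℝ) :
    matchedResponse p (-t) = matchedResponse p t := by
  unfold matchedResponse
  rw [← integral_sub_right_eq_self (fun s => p s * p (s - -t)) t]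
  refine integral_congr_ae (Eventually.of_forall fun s => ?_)
  simp only [sub_neg_eq_add, sub_add_cancel]
  ring

/-- The Toeplitz entries are the Fourier coefficients of the folded spectrum. The inversion formula
gives exponents of the opposite sign, which the evenness of the matched response corrects. -/
theorem IsPulseSpectrum.matchedResponse_eq (hG : IsPulseSpectrum p T β G) (hT : 0 < T)
    (hβ : 0 ≤ β) (hδ : 0 < δ) (hδβ : δ < 1 / (1 + β)) (k : ℤ) :
    (matchedResponse p ((k : ℝ) * δ * T) : ℂ) = ∫ x in (-(1 / 2) : ℝ)..(1 / 2),
      (scaledSpectrum G δ T x : ℂ) *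
        Complex.exp (-2 * Real.pi * Complex.I * (k : ℂ) * (x : ℂ)) := by
  have hδT : 0 < δ * T := mul_pos hδ hT
  have hsub := Measure.integral_comp_div (fun f : ℝ => (G f : ℂ) *
    Complex.exp (2 * Real.pi * Complex.I * f * ((-((k : ℝ) * δ * T) : ℝ) : ℂ))) (δ * T)
  rw [← hG.inversion, matchedResponse_neg, abs_of_pos hδT, Complex.real_smul] at hsub
  have hne : ((δ * T : ℝ) : ℂ) ≠ 0 := by exact_mod_cast hδT.ne'
  have hb := half_band_lt hβ hδβ
  rw [intervalIntegral.integral_of_le (by norm_num),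
    setIntegral_eq_integral_of_forall_compl_eq_zero]
  · have h2 : (matchedResponse p ((k : ℝ) * δ * T) : ℂ) = ((1 / (δ * T) : ℝ) : ℂ) *
        (((δ * T : ℝ) : ℂ) * (matchedResponse p ((k : ℝ) * δ * T) : ℂ)) := by
      rw [Complex.ofReal_div, Complex.ofReal_one, ← mul_assoc, one_div_mul_cancel hne, one_mul]
    rw [h2, ← hsub, ← integral_const_mul]
    refine integral_congr_ae (Eventually.of_forall fun x => ?_)
    simp only [scaledSpectrum]
    rw [Complex.ofReal_mul, mul_assoc ((1 / (δ * T) : ℝ) : ℂ)]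
    congr 3
    push_cast at hne ⊢
    have h3 : (δ : ℂ) ≠ 0 := left_ne_zero_of_mul hne
    have h4 : (T : ℂ) ≠ 0 := right_ne_zero_of_mul hne
    field_simp
  · intro x hx
    rw [hG.scaledSpectrum_eq_zero hT hδ, Complex.ofReal_zero, zero_mul]
    by_contra hlt
    have := abs_lt.1 (not_le.1 hlt)
    exact hx ⟨by linarith, by linarith⟩

theorem abs_freqIndex_div_le (M : ℕ) (j : Fin (blockLength M)) :
    |(freqIndex M j : ℝ) / (blockLength M : ℝ)| ≤ 1 / 2 := by
  have hN : (0 : ℝ) < (blockLength M : ℝ) := by positivity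
  have hj := j.isLt
  have h1 : |freqIndex M j| ≤ M := abs_le.2 (by simp only [freqIndex, blockLength] at *; omega)
  have h2 : |(freqIndex M j : ℝ)| ≤ M := by exact_mod_cast h1
  rw [abs_div, abs_of_pos hN, div_le_iff₀ hN]
  push_cast
  linarith

theorem IsPulseSpectrum.dftISI_eq (hG : IsPulseSpectrum p T β G) (hT : 0 < T)
    (hβ : 0 ≤ β) (hδ : 0 < δ) (hδβ : δ < 1 / (1 + β)) (M : ℕ) :
    dftISI G δ T M = dftMatrix M * Matrix.diagonal (fun j =>
      (scaledSpectrum G δ T ((freqIndex M j : ℝ) / (blockLength M : ℝ)) : ℂ)) *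
        (dftMatrix M)ᴴ := by
  unfold dftISI
  simp_rw [hG.foldedSpectrum_eq hT hβ hδ hδβ (abs_freqIndex_div_le M _)]

theorem IsPulseSpectrum.tendsto_toeplitzISI_sub_dftISI (hG : IsPulseSpectrum p T β G) (hT : 0 < T)
    (hβ : 0 ≤ β) (hδ : 0 < δ) (hδβ : δ < 1 / (1 + β)) :
    Tendsto (fun M : ℕ => 1 / (blockLength M : ℝ) *
        ∑ n, ∑ m, ‖(toeplitzISI p δ T M - dftISI G δ T M) n m‖ ^ 2) atTop (𝓝 0) := by
  obtain ⟨B, hB⟩ := hG.bounded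
  have h := tendsto_toeplitz_sub_dft (F := scaledSpectrum G δ T) (B := 1 / (δ * T) * B)
    (t := fun k => (matchedResponse p ((k : ℝ) * δ * T) : ℂ)) (fun x => ?_)
    (hG.continuousOn_scaledSpectrum hT hδ) (fun x => hG.scaledSpectrum_eq_zero hT hδ)
    (measurable_const.mul (hG.measurable.comp (by fun_prop)))
    (hG.matchedResponse_eq hT hβ hδ hδβ)
  · refine h.congr fun M => ?_
    congr 1
    refine Finset.sum_congr rfl fun n _ => Finset.sum_congr rfl fun m _ => ?_
    rw [Matrix.sub_apply, hG.dftISI_eq hT hβ hδ hδβ, dft_diagonal_apply]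
    simp [toeplitzISI]
  · rw [abs_of_nonneg (hG.scaledSpectrum_nonneg hT hδ x)]
    exact mul_le_mul_of_nonneg_left (hB _) (by positivity)

/-! ### The samples of the optimal spectrum -/

theorem IsPulseSpectrum.phi_ne_zero_iff (hG : IsPulseSpectrum p T β G) (hT : 0 < T)
    (hβ : 0 ≤ β) (hδ : 0 < δ) (f : ℝ) : phi G δ T β f ≠ 0 ↔ |f| < δ * (1 + β) / 2 := by
  unfold phi
  split_ifs with h
  · have h1 := (hG.ne_zero_iff hT hδ f).2 h
    have h2 : 1 + β ≠ 0 := by positivity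
    simp [h, h1, h2, hT.ne']
  · simp [h]

theorem IsPulseSpectrum.phi_nonneg (hG : IsPulseSpectrum p T β G) (hT : 0 < T)
    (hβ : 0 ≤ β) (f : ℝ) : 0 ≤ phi G δ T β f := by
  unfold phi
  split_ifs
  · have := hG.nonneg (f / (δ * T))
    positivity
  · exact le_rfl

theorem IsPulseSpectrum.phi_mul_scaledSpectrum (hG : IsPulseSpectrum p T β G) (hT : 0 < T)
    (hβ : 0 ≤ β) (hδ : 0 < δ) (f : ℝ) :
    P * δ * T * phi G δ T β f * scaledSpectrum G δ T f = flatSpectrum T β δ P f := by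
  unfold phi scaledSpectrum flatSpectrum
  split_ifs with h
  · have h1 := (hG.ne_zero_iff hT hδ f).2 h
    have h2 : 1 + β ≠ 0 := by positivity
    field_simp
  · simp

/-- The samples in the band are `|i| < b N`, with `b = δ (1 + β) / 2`; there are
`2 ⌈b N⌉ - 1` of them. -/
theorem IsPulseSpectrum.numNonzero_eq (hG : IsPulseSpectrum p T β G) (hT : 0 < T)
    (hβ : 0 ≤ β) (hδ : 0 < δ) (hδβ : δ < 1 / (1 + β)) (M : ℕ) :
    (numNonzero G δ T β M : ℤ) = 2 * ⌈δ * (1 + β) / 2 * (blockLength M : ℝ)⌉ - 1 := by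
  have hN : (0 : ℝ) < (blockLength M : ℝ) := by positivity
  have hb := half_band_lt hβ hδβ
  have hb0 : 0 < δ * (1 + β) / 2 := by positivity
  set K := ⌈δ * (1 + β) / 2 * (blockLength M : ℝ)⌉ with hK
  have hKpos : 0 < K := Int.ceil_pos.2 (mul_pos hb0 hN)
  have hset : {i : ℤ | |i| ≤ M ∧ phi G δ T β ((i : ℝ) / (blockLength M : ℝ)) ≠ 0} =
      ((Finset.Icc (-(K - 1)) (K - 1) : Finset ℤ) : Set ℤ) := by
    ext i
    rw [Set.mem_ofPred_eq, hG.phi_ne_zero_iff hT hβ hδ, abs_div, abs_of_pos hN, div_lt_iff₀ hN,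
      Finset.coe_Icc, Set.mem_Icc, ← abs_le]
    have h1 : |(i : ℝ)| < δ * (1 + β) / 2 * (blockLength M : ℝ) ↔ |i| < K := by
      rw [hK, Int.lt_ceil]
      push_cast
      rfl
    rw [h1]
    constructor
    · rintro ⟨_, h⟩
      omega
    · intro h
      refine ⟨?_, by omega⟩
      have h2 := h1.2 (by omega)
      have h3 : |(i : ℝ)| < M + 1 := by
        push_cast at h2
        nlinarith
      have h4 : |i| < M + 1 := by exact_mod_cast h3
      omega
  rw [numNonzero, hset, Set.ncard_coe_finset, Int.card_Icc]
  omega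

theorem IsPulseSpectrum.lambdaTilde_eq_phi (hG : IsPulseSpectrum p T β G) (hT : 0 < T)
    (hβ : 0 ≤ β) (hδ : 0 < δ) (hδβ : δ < 1 / (1 + β)) (M : ℕ) (i : ℤ) :
    lambdaTilde G δ T β M i = phi G δ T β ((i : ℝ) / (blockLength M : ℝ)) := by
  have hN : (0 : ℝ) < (blockLength M : ℝ) := by positivity
  have hZ := hG.numNonzero_eq hT hβ hδ hδβ M
  have hZR : (numNonzero G δ T β M : ℝ) =
      2 * (⌈δ * (1 + β) / 2 * (blockLength M : ℝ)⌉ : ℝ) - 1 := by exact_mod_cast hZ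
  have hiff : |(i : ℝ)| < (numNonzero G δ T β M : ℝ) / 2 ↔
      |(i : ℝ) / (blockLength M : ℝ)| < δ * (1 + β) / 2 := by
    rw [abs_div, abs_of_pos hN, div_lt_iff₀ hN, hZR, ← Int.cast_abs,
      ← Int.lt_ceil (a := δ * (1 + β) / 2 * (blockLength M : ℝ))]
    constructor
    · intro h
      have : ((|i| : ℤ) : ℝ) < (⌈δ * (1 + β) / 2 * (blockLength M : ℝ)⌉ : ℝ) := by linarith
      exact_mod_cast this
    · intro h
      have : ((|i| : ℤ) : ℝ) ≤ (⌈δ * (1 + β) / 2 * (blockLength M : ℝ)⌉ : ℝ) - 1 := by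
        exact_mod_cast Int.le_sub_one_of_lt h
      linarith
  have harg : (i : ℝ) / (blockLength M * δ * T) = (i : ℝ) / (blockLength M : ℝ) / (δ * T) := by
    rw [div_div, mul_assoc]
  unfold lambdaTilde phi
  rw [harg]
  simp only [hiff]

end Spectrum

/-! ### The optimal input spectrum -/

theorem log_one_add_le_tangent {c x u : ℝ} (hc : 0 < c) (hx : 0 ≤ x) (hu : 0 ≤ u) :
    Real.log (1 + c * u) ≤ Real.log (1 + c * x) + c / (1 + c * x) * (u - x) ∧
      (Real.log (1 + c * u) = Real.log (1 + c * x) + c / (1 + c * x) * (u - x) → u = x) := by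
  have hxp : 0 < 1 + c * x := by positivity
  have hup : 0 < 1 + c * u := by positivity
  have hdiv := div_pos hup hxp
  have h1 : Real.log ((1 + c * u) / (1 + c * x)) = Real.log (1 + c * u) - Real.log (1 + c * x) :=
    Real.log_div hup.ne' hxp.ne'
  have h2 : (1 + c * u) / (1 + c * x) - 1 = c / (1 + c * x) * (u - x) := by
    field_simp
    ring
  constructor
  · have := Real.log_le_sub_one_of_pos hdiv
    linarith
  · intro h
    by_contra hne
    have hne1 : (1 + c * u) / (1 + c * x) ≠ 1 := by
      rw [Ne, div_eq_one_iff_eq hxp.ne']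
      intro h3
      exact hne (mul_left_cancel₀ hc.ne' (add_left_cancel h3))
    have := Real.log_lt_sub_one_of_pos hdiv hne1
    linarith

theorem integrable_log_one_add {α : Type*} [MeasurableSpace α] {μ : Measure α} {u : α → ℝ} {c : ℝ}
    (hc : 0 < c) (hu : Integrable u μ) (hu0 : ∀ᵐ a ∂μ, 0 ≤ u a) :
    Integrable (fun a => Real.log (1 + c * u a)) μ := by
  refine (hu.const_mul c).mono' ?_ ?_
  · exact (Real.measurable_log.comp_aemeasurable
      ((hu.aemeasurable.const_mul c).const_add 1)).aestronglyMeasurable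
  · filter_upwards [hu0] with a ha
    have h1 : 0 ≤ c * u a := by positivity
    rw [Real.norm_of_nonneg (Real.log_nonneg (by linarith))]
    have := Real.log_le_sub_one_of_pos (by linarith : 0 < 1 + c * u a)
    linarith

/-- Among received spectra supported where the flat spectrum `x` is, and of no larger total
power, the flat one maximizes the rate. -/
theorem integral_log_one_add_le {α : Type*} [MeasurableSpace α] {μ : Measure α} {u x : α → ℝ}
    {c x₀ : ℝ} (hc : 0 < c) (hx₀ : 0 ≤ x₀) (hu : Integrable u μ) (hx : Integrable x μ)
    (hu0 : ∀ᵐ a ∂μ, 0 ≤ u a) (hflat : ∀ᵐ a ∂μ, x a = x₀ ∨ x a = 0 ∧ u a = 0)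
    (hle : ∫ a, u a ∂μ ≤ ∫ a, x a ∂μ) :
    ∫ a, Real.log (1 + c * u a) ∂μ ≤ ∫ a, Real.log (1 + c * x a) ∂μ ∧
      (∫ a, Real.log (1 + c * u a) ∂μ = ∫ a, Real.log (1 + c * x a) ∂μ → u =ᵐ[μ] x) := by
  have hx0 : ∀ᵐ a ∂μ, 0 ≤ x a := by
    filter_upwards [hflat] with a ha
    rcases ha with h | h
    · rw [h]; exact hx₀
    · rw [h.1]
  have hiu := integrable_log_one_add hc hu hu0
  have hix := integrable_log_one_add hc hx hx0
  set κ := c / (1 + c * x₀) with hκ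
  have hκ0 : 0 ≤ κ := by positivity
  set d : α → ℝ := fun a =>
    Real.log (1 + c * x a) + κ * (u a - x a) - Real.log (1 + c * u a) with hd
  have hid : Integrable d μ := (hix.add ((hu.sub hx).const_mul κ)).sub hiu
  have hd0 : 0 ≤ᵐ[μ] d := by
    filter_upwards [hflat, hu0] with a ha hua
    simp only [Pi.zero_apply, hd]
    rcases ha with h | h
    · have := (log_one_add_le_tangent hc hx₀ hua).1
      rw [h]
      linarith
    · simp [h.1, h.2]
  have hint : ∫ a, d a ∂μ = ∫ a, Real.log (1 + c * x a) ∂μ +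
      κ * (∫ a, u a ∂μ - ∫ a, x a ∂μ) - ∫ a, Real.log (1 + c * u a) ∂μ := by
    have hκi : Integrable (fun a => κ * (u a - x a)) μ := (hu.sub hx).const_mul κ
    have hsum : Integrable (fun a => Real.log (1 + c * x a) + κ * (u a - x a)) μ := hix.add hκi
    simp only [hd]
    rw [integral_sub hsum hiu, integral_add hix hκi, integral_const_mul, integral_sub hu hx]
  have hdn := integral_nonneg_of_ae hd0
  have hκd : κ * (∫ a, u a ∂μ - ∫ a, x a ∂μ) ≤ 0 :=
    mul_nonpos_of_nonneg_of_nonpos hκ0 (by linarith)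
  refine ⟨by linarith, fun heq => ?_⟩
  have hz : ∫ a, d a ∂μ = 0 := by linarith
  rw [integral_eq_zero_iff_of_nonneg_ae hd0 hid] at hz
  filter_upwards [hz, hflat, hu0] with a ha hfa hua
  simp only [Pi.zero_apply, hd] at ha
  rcases hfa with h | h
  · rw [h] at ha ⊢
    exact (log_one_add_le_tangent hc hx₀ hua).2 (by linarith)
  · rw [h.1, h.2]

section OptimalSpectrum

variable {p G : ℝ → ℝ} {T β δ P s : ℝ} {h : ℂ}

theorem mem_Icc_half_iff {f : ℝ} : f ∈ Set.Icc (-(1 / 2) : ℝ) (1 / 2) ↔ |f| ≤ 1 / 2 := abs_le.symm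

theorem flatSpectrum_nonneg (hT : 0 < T) (hβ : 0 ≤ β) (hP : 0 < P) (f : ℝ) :
    0 ≤ flatSpectrum T β δ P f := by
  unfold flatSpectrum
  split_ifs <;> positivity

theorem flatSpectrum_eq_indicator (T β δ P : ℝ) :
    flatSpectrum T β δ P =
      (Set.Ioo (-(δ * (1 + β) / 2)) (δ * (1 + β) / 2)).indicator fun _ => P * T / (1 + β) := by
  funext f
  simp only [flatSpectrum, Set.indicator_apply, Set.mem_Ioo, abs_lt]

theorem integral_flatSpectrum (hβ : 0 ≤ β) (hδ : 0 < δ) (hδβ : δ < 1 / (1 + β)) :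
    IntegrableOn (flatSpectrum T β δ P) (Set.Icc (-(1 / 2) : ℝ) (1 / 2)) ∧
      ∫ f in Set.Icc (-(1 / 2) : ℝ) (1 / 2), flatSpectrum T β δ P f = P * (δ * T) := by
  have hb := half_band_lt hβ hδβ
  rw [flatSpectrum_eq_indicator]
  constructor
  · exact (integrableOn_const (by simp)).indicator measurableSet_Ioo
  · rw [setIntegral_indicator measurableSet_Ioo, Set.inter_eq_self_of_subset_right,
      setIntegral_const, Real.volume_real_Ioo_of_le, smul_eq_mul]
    · have : 1 + β ≠ 0 := by positivity
      field_simp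
      ring
    · have : 0 ≤ δ * (1 + β) / 2 := by positivity
      linarith
    · intro f hf
      exact ⟨by linarith [hf.1], by linarith [hf.2]⟩

theorem IsPulseSpectrum.opt_mul_foldedSpectrum (hG : IsPulseSpectrum p T β G) (hT : 0 < T)
    (hβ : 0 ≤ β) (hδ : 0 < δ) (hδβ : δ < 1 / (1 + β)) {f : ℝ} (hf : |f| ≤ 1 / 2) :
    P * δ * T * phi G δ T β f * foldedSpectrum G δ T f = flatSpectrum T β δ P f := by
  rw [hG.foldedSpectrum_eq hT hβ hδ hδβ hf, hG.phi_mul_scaledSpectrum hT hβ hδ]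

theorem IsPulseSpectrum.admissibleSpectrum_opt (hG : IsPulseSpectrum p T β G) (hT : 0 < T)
    (hβ : 0 ≤ β) (hδ : 0 < δ) (hδβ : δ < 1 / (1 + β)) (hP : 0 < P) :
    AdmissibleSpectrum G δ T P (fun f => P * δ * T * phi G δ T β f) where
  measurable := by
    refine measurable_const.mul (Measurable.ite ?_ ?_ measurable_const)
    · exact measurableSet_lt (by fun_prop) measurable_const
    · exact measurable_const.div ((hG.measurable.comp (by fun_prop)).mul_const _)
  nonneg f := mul_nonneg (by positivity) (hG.phi_nonneg hT hβ f)
  integrable := by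
    refine (integral_flatSpectrum (T := T) (P := P) hβ hδ hδβ).1.congr_fun (fun f hf => ?_)
      measurableSet_Icc
    exact (hG.opt_mul_foldedSpectrum hT hβ hδ hδβ (mem_Icc_half_iff.1 hf)).symm
  power_le := by
    rw [spectralPower, setIntegral_congr_fun measurableSet_Icc fun f hf =>
      hG.opt_mul_foldedSpectrum hT hβ hδ hδβ (mem_Icc_half_iff.1 hf),
      (integral_flatSpectrum hβ hδ hδβ).2]
    have : 0 < δ * T := mul_pos hδ hT
    refine le_of_eq ?_
    field_simp

theorem spectralRate_eq (G : ℝ → ℝ) (δ T : ℝ) (h : ℂ) (s : ℝ) (S : ℝ → ℝ) :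
    spectralRate G δ T h s S = 1 / (δ * T) * ((∫ f in Set.Icc (-(1 / 2) : ℝ) (1 / 2),
      Real.log (1 + ‖h‖ ^ 2 / s * (S f * foldedSpectrum G δ T f))) / Real.log 2) := by
  simp only [spectralRate, Real.logb]
  rw [integral_div]

theorem IsPulseSpectrum.spectralRate_opt (hG : IsPulseSpectrum p T β G) (hT : 0 < T)
    (hβ : 0 ≤ β) (hδ : 0 < δ) (hδβ : δ < 1 / (1 + β)) :
    spectralRate G δ T h s (fun f => P * δ * T * phi G δ T β f) =
      1 / (δ * T) * ((∫ f in Set.Icc (-(1 / 2) : ℝ) (1 / 2),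
        Real.log (1 + ‖h‖ ^ 2 / s * flatSpectrum T β δ P f)) / Real.log 2) := by
  rw [spectralRate_eq]
  congr 2
  refine setIntegral_congr_fun measurableSet_Icc fun f hf => ?_
  rw [hG.opt_mul_foldedSpectrum hT hβ hδ hδβ (mem_Icc_half_iff.1 hf)]

theorem IsPulseSpectrum.spectralRate_le_opt (hG : IsPulseSpectrum p T β G) (hT : 0 < T)
    (hβ : 0 ≤ β) (hδ : 0 < δ) (hδβ : δ < 1 / (1 + β)) (hP : 0 < P) (hs : 0 < s) (hh : h ≠ 0)
    {S : ℝ → ℝ} (hS : AdmissibleSpectrum G δ T P S) :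
    spectralRate G δ T h s S ≤ spectralRate G δ T h s (fun f => P * δ * T * phi G δ T β f) ∧
      (spectralRate G δ T h s S = spectralRate G δ T h s (fun f => P * δ * T * phi G δ T β f) →
        ∀ᵐ f ∂volume.restrict (Set.Icc (-(1 / 2) : ℝ) (1 / 2)),
          foldedSpectrum G δ T f ≠ 0 → S f = P * δ * T * phi G δ T β f) := by
  have hδT : 0 < δ * T := mul_pos hδ hT
  have hc : 0 < ‖h‖ ^ 2 / s := div_pos (pow_pos (norm_pos_iff.2 hh) 2) hs
  have hlog : 0 < Real.log 2 := Real.log_pos one_lt_two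
  have hx₀ : 0 ≤ P * T / (1 + β) := by positivity
  have hmem := ae_restrict_mem (μ := volume) (measurableSet_Icc (a := (-(1 / 2) : ℝ)) (b := 1 / 2))
  have hflat := integral_flatSpectrum (T := T) (P := P) hβ hδ hδβ
  obtain ⟨hle, heq⟩ := integral_log_one_add_le (x := flatSpectrum T β δ P) hc hx₀ hS.integrable
    hflat.1 (by
      filter_upwards [hmem] with f hf
      rw [hG.foldedSpectrum_eq hT hβ hδ hδβ (mem_Icc_half_iff.1 hf)]
      exact mul_nonneg (hS.nonneg f) (hG.scaledSpectrum_nonneg hT hδ f)) (by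
      filter_upwards [hmem] with f hf
      unfold flatSpectrum
      split_ifs with hband
      · exact Or.inl rfl
      · refine Or.inr ⟨rfl, ?_⟩
        rw [hG.foldedSpectrum_eq hT hβ hδ hδβ (mem_Icc_half_iff.1 hf),
          hG.scaledSpectrum_eq_zero hT hδ (not_lt.1 hband), mul_zero]) (by
      have := hS.power_le
      rw [spectralPower, one_div_mul_eq_div, div_le_iff₀ hδT] at this
      rw [hflat.2]
      exact this)
  rw [hG.spectralRate_opt hT hβ hδ hδβ, spectralRate_eq]
  constructor
  · exact mul_le_mul_of_nonneg_left (div_le_div_of_nonneg_right hle hlog.le) (by positivity)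
  · intro hE
    have h1 := mul_left_cancel₀ (by positivity : 1 / (δ * T) ≠ 0) hE
    have h2 := (div_left_inj' hlog.ne').1 h1
    filter_upwards [heq h2, hmem] with f hf hfm hne
    rw [← hG.opt_mul_foldedSpectrum hT hβ hδ hδβ (mem_Icc_half_iff.1 hfm)] at hf
    exact mul_right_cancel₀ hne hf

end OptimalSpectrum

/-! ### Diagonalization of the block channel -/

/-- The factor `K = D Λ^{1/2}` of the channel matrix `D Λ D† = K K†`, where `Λ = diag F`. -/
noncomputable def channelFactor (M : ℕ) (F : Fin (blockLength M) → ℝ) :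
    Matrix (Fin (blockLength M)) (Fin (blockLength M)) ℂ :=
  dftMatrix M * Matrix.diagonal fun j => ((Real.sqrt (F j) : ℝ) : ℂ)

section Block

variable {M : ℕ} {F : Fin (blockLength M) → ℝ}

theorem conjTranspose_diagonal_ofReal (d : Fin (blockLength M) → ℝ) :
    (Matrix.diagonal fun j => (d j : ℂ))ᴴ = Matrix.diagonal fun j => (d j : ℂ) := by
  rw [Matrix.diagonal_conjTranspose]
  congr 1
  funext j
  simp

theorem conjTranspose_channelFactor : (channelFactor M F)ᴴ =
    (Matrix.diagonal fun j => ((Real.sqrt (F j) : ℝ) : ℂ)) * (dftMatrix M)ᴴ := by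
  rw [channelFactor, Matrix.conjTranspose_mul, conjTranspose_diagonal_ofReal]

theorem channelFactor_mul_conjTranspose (hF : ∀ j, 0 ≤ F j) :
    channelFactor M F * (channelFactor M F)ᴴ =
      dftMatrix M * Matrix.diagonal (fun j => (F j : ℂ)) * (dftMatrix M)ᴴ := by
  rw [conjTranspose_channelFactor, channelFactor, Matrix.mul_assoc, ← Matrix.mul_assoc
    (Matrix.diagonal _) (Matrix.diagonal _), Matrix.diagonal_mul_diagonal, ← Matrix.mul_assoc]
  congr 3
  funext j
  rw [← Complex.ofReal_mul, Real.mul_self_sqrt (hF j)]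

theorem received_diagonal (hF : ∀ j, 0 ≤ F j) (r : Fin (blockLength M) → ℝ) :
    (channelFactor M F)ᴴ * (dftMatrix M * Matrix.diagonal (fun j => (r j : ℂ)) * (dftMatrix M)ᴴ) *
      channelFactor M F = Matrix.diagonal fun j => ((r j * F j : ℝ) : ℂ) := by
  have hD := dftMatrix_conjTranspose_mul_self M
  rw [conjTranspose_channelFactor, channelFactor]
  calc _ = (Matrix.diagonal fun j => ((Real.sqrt (F j) : ℝ) : ℂ)) *
        ((dftMatrix M)ᴴ * dftMatrix M) * Matrix.diagonal (fun j => (r j : ℂ)) *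
        ((dftMatrix M)ᴴ * dftMatrix M) * Matrix.diagonal fun j => ((Real.sqrt (F j) : ℝ) : ℂ) := by
        simp only [Matrix.mul_assoc]
    _ = _ := by
        rw [hD, Matrix.mul_one, Matrix.mul_one, Matrix.diagonal_mul_diagonal,
          Matrix.diagonal_mul_diagonal]
        congr 1
        funext j
        rw [← Complex.ofReal_mul, ← Complex.ofReal_mul, mul_right_comm, Real.mul_self_sqrt (hF j),
          mul_comm]

theorem received_apply_eq_zero {j : Fin (blockLength M)} (hj : F j = 0)
    (Q : Matrix (Fin (blockLength M)) (Fin (blockLength M)) ℂ) :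
    ((channelFactor M F)ᴴ * Q * channelFactor M F) j j = 0 := by
  rw [channelFactor, ← Matrix.mul_assoc, Matrix.mul_diagonal, hj]
  simp

theorem transmitPower_eq (δ T : ℝ) (K Q : Matrix (Fin (blockLength M)) (Fin (blockLength M)) ℂ) :
    transmitPower δ T (K * Kᴴ) Q = 1 / (blockLength M * δ * T) * (Kᴴ * Q * K).trace.re := by
  rw [transmitPower, ← Matrix.mul_assoc, Matrix.trace_mul_comm, Matrix.mul_assoc]

theorem blockRate_eq (δ T : ℝ) (h : ℂ) (s : ℝ)
    (K Q : Matrix (Fin (blockLength M)) (Fin (blockLength M)) ℂ) :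
    blockRate δ T h s (K * Kᴴ) Q = 1 / (blockLength M * δ * T) *
      (Real.log (1 + ((‖h‖ ^ 2 / s : ℝ) : ℂ) • (Kᴴ * Q * K)).det.re / Real.log 2) := by
  rw [blockRate, Real.logb, ← Matrix.mul_assoc, ← Matrix.smul_mul, Matrix.det_one_add_mul_comm,
    Matrix.mul_smul, ← Matrix.mul_assoc]

end Block

/-! ### The optimal covariance -/

section OptimalCovariance

variable {p G : ℝ → ℝ} {T β δ P s : ℝ} {h : ℂ}

/-- The sample of `f` at the frequency `i / N` in position `j`, where `i = j - M`. -/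
noncomputable def gridSample (f : ℝ → ℝ) (M : ℕ) (j : Fin (blockLength M)) : ℝ :=
  f ((freqIndex M j : ℝ) / (blockLength M : ℝ))

theorem IsPulseSpectrum.dftISI_eq_factor (hG : IsPulseSpectrum p T β G) (hT : 0 < T)
    (hβ : 0 ≤ β) (hδ : 0 < δ) (hδβ : δ < 1 / (1 + β)) (M : ℕ) :
    dftISI G δ T M = channelFactor M (gridSample (scaledSpectrum G δ T) M) *
      (channelFactor M (gridSample (scaledSpectrum G δ T) M))ᴴ := by
  rw [hG.dftISI_eq hT hβ hδ hδβ, channelFactor_mul_conjTranspose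
    (F := gridSample (scaledSpectrum G δ T) M) fun j => hG.scaledSpectrum_nonneg hT hδ _]
  rfl

theorem IsPulseSpectrum.optCovariance_eq (hG : IsPulseSpectrum p T β G) (hT : 0 < T)
    (hβ : 0 ≤ β) (hδ : 0 < δ) (hδβ : δ < 1 / (1 + β)) (M : ℕ) :
    optCovariance G δ T β P M = dftMatrix M * Matrix.diagonal (fun j =>
      ((P * δ * T * gridSample (phi G δ T β) M j : ℝ) : ℂ)) * (dftMatrix M)ᴴ := by
  unfold optCovariance
  rw [← Matrix.smul_mul, ← Matrix.mul_smul, ← Matrix.diagonal_smul]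
  congr 3
  funext j
  rw [Pi.smul_apply, smul_eq_mul, hG.lambdaTilde_eq_phi hT hβ hδ hδβ, gridSample,
    ← Complex.ofReal_mul]

theorem IsPulseSpectrum.posSemidef_optCovariance (hG : IsPulseSpectrum p T β G) (hT : 0 < T)
    (hβ : 0 ≤ β) (hδ : 0 < δ) (hδβ : δ < 1 / (1 + β)) (hP : 0 < P) (M : ℕ) :
    (optCovariance G δ T β P M).PosSemidef := by
  rw [hG.optCovariance_eq hT hβ hδ hδβ]
  refine Matrix.PosSemidef.mul_mul_conjTranspose_same (Matrix.PosSemidef.diagonal fun j => ?_) _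
  have := hG.phi_nonneg (δ := δ) hT hβ ((freqIndex M j : ℝ) / (blockLength M : ℝ))
  have h2 : 0 ≤ P * δ * T * gridSample (phi G δ T β) M j := mul_nonneg (by positivity) this
  exact Complex.zero_le_real.2 h2

theorem IsPulseSpectrum.received_optCovariance (hG : IsPulseSpectrum p T β G) (hT : 0 < T)
    (hβ : 0 ≤ β) (hδ : 0 < δ) (hδβ : δ < 1 / (1 + β)) (M : ℕ) :
    (channelFactor M (gridSample (scaledSpectrum G δ T) M))ᴴ * optCovariance G δ T β P M *
      channelFactor M (gridSample (scaledSpectrum G δ T) M) =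
        Matrix.diagonal fun j => (gridSample (flatSpectrum T β δ P) M j : ℂ) := by
  rw [hG.optCovariance_eq hT hβ hδ hδβ, received_diagonal
    (F := gridSample (scaledSpectrum G δ T) M) fun j => hG.scaledSpectrum_nonneg hT hδ _]
  congr 1
  funext j
  rw [gridSample, gridSample, gridSample, hG.phi_mul_scaledSpectrum hT hβ hδ]

theorem IsPulseSpectrum.transmitPower_opt (hG : IsPulseSpectrum p T β G) (hT : 0 < T)
    (hβ : 0 ≤ β) (hδ : 0 < δ) (hδβ : δ < 1 / (1 + β)) (M : ℕ) :
    transmitPower δ T (dftISI G δ T M) (optCovariance G δ T β P M) =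
      1 / (blockLength M * δ * T) * ∑ j, gridSample (flatSpectrum T β δ P) M j := by
  rw [hG.dftISI_eq_factor hT hβ hδ hδβ, transmitPower_eq, hG.received_optCovariance hT hβ hδ hδβ,
    Matrix.trace_diagonal, ← Complex.ofReal_sum, Complex.ofReal_re]

theorem IsPulseSpectrum.blockRate_opt (hG : IsPulseSpectrum p T β G) (hT : 0 < T)
    (hβ : 0 ≤ β) (hδ : 0 < δ) (hδβ : δ < 1 / (1 + β)) (hP : 0 < P) (hs : 0 < s) (M : ℕ) :
    blockRate δ T h s (dftISI G δ T M) (optCovariance G δ T β P M) =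
      1 / (blockLength M * δ * T) *
        ((∑ j, Real.log (1 + ‖h‖ ^ 2 / s * gridSample (flatSpectrum T β δ P) M j)) /
          Real.log 2) := by
  rw [hG.dftISI_eq_factor hT hβ hδ hδβ, blockRate_eq, hG.received_optCovariance hT hβ hδ hδβ,
    ← Matrix.diagonal_smul, ← Matrix.diagonal_one, Matrix.diagonal_add, Matrix.det_diagonal]
  have : ∀ j, (1 : ℂ) + (((‖h‖ ^ 2 / s : ℝ) : ℂ) • fun j =>
      (gridSample (flatSpectrum T β δ P) M j : ℂ)) j =
      ((1 + ‖h‖ ^ 2 / s * gridSample (flatSpectrum T β δ P) M j : ℝ) : ℂ) := fun j => by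
    rw [Pi.smul_apply, smul_eq_mul]
    push_cast
    ring
  simp_rw [this]
  rw [← Complex.ofReal_prod, Complex.ofReal_re, Real.log_prod]
  intro j _
  have h1 : 0 ≤ gridSample (flatSpectrum T β δ P) M j := flatSpectrum_nonneg hT hβ hP _
  positivity

/-- The rate of any covariance exceeds that of the optimal one by at most a multiple of the excess
power. Since the optimal received spectrum is constant on the band, the tangent of the
log-determinant there depends on the covariance through its transmit power only. -/
theorem IsPulseSpectrum.blockRate_le (hG : IsPulseSpectrum p T β G) (hT : 0 < T)
    (hβ : 0 ≤ β) (hδ : 0 < δ) (hδβ : δ < 1 / (1 + β)) (hP : 0 < P) (hs : 0 < s) (hh : h ≠ 0)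
    (M : ℕ) {Q : Matrix (Fin (blockLength M)) (Fin (blockLength M)) ℂ} (hQ : Q.PosSemidef) :
    let κ := ‖h‖ ^ 2 / s / (1 + ‖h‖ ^ 2 / s * (P * T / (1 + β))) / Real.log 2
    let bound := blockRate δ T h s (dftISI G δ T M) (optCovariance G δ T β P M) +
      κ * (transmitPower δ T (dftISI G δ T M) Q -
        transmitPower δ T (dftISI G δ T M) (optCovariance G δ T β P M))
    blockRate δ T h s (dftISI G δ T M) Q ≤ bound ∧
      (blockRate δ T h s (dftISI G δ T M) Q = bound →
        dftISI G δ T M * Q * dftISI G δ T M =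
          dftISI G δ T M * optCovariance G δ T β P M * dftISI G δ T M) := by
  intro κ bound
  have hN : (0 : ℝ) < (blockLength M : ℝ) := by positivity
  have hlog : 0 < Real.log 2 := Real.log_pos one_lt_two
  set c := ‖h‖ ^ 2 / s with hcdef
  have hc : 0 < c := div_pos (pow_pos (norm_pos_iff.2 hh) 2) hs
  set F := gridSample (scaledSpectrum G δ T) M with hF
  set x := gridSample (flatSpectrum T β δ P) M with hx
  set K := channelFactor M F with hK
  have hA : dftISI G δ T M = K * Kᴴ := hG.dftISI_eq_factor hT hβ hδ hδβ M
  have hx0 : ∀ j, 0 ≤ x j := fun j => flatSpectrum_nonneg hT hβ hP _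
  have hBps : (Kᴴ * Q * K).PosSemidef := hQ.conjTranspose_mul_mul_same K
  obtain ⟨hle, heq⟩ := hBps.log_det_one_add_smul_le hc hx0
  have htangent : ∑ j, c * (((Kᴴ * Q * K) j j).re - x j) / (1 + c * x j) =
      c / (1 + c * (P * T / (1 + β))) * ((Kᴴ * Q * K).trace.re - ∑ j, x j) := by
    rw [Matrix.trace, Complex.re_sum, ← Finset.sum_sub_distrib, Finset.mul_sum]
    refine Finset.sum_congr rfl fun j _ => ?_
    simp only [Matrix.diag_apply]
    -- off the band neither spectrum receives anything, so the tangent slope there is immaterial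
    by_cases hband : |(freqIndex M j : ℝ) / (blockLength M : ℝ)| < δ * (1 + β) / 2
    · have : x j = P * T / (1 + β) := by
        simp only [hx, gridSample, flatSpectrum, if_pos hband]
      rw [this]
      ring
    · have h1 : x j = 0 := by
        simp only [hx, gridSample, flatSpectrum, if_neg hband]
      have h2 : F j = 0 := hG.scaledSpectrum_eq_zero hT hδ (not_lt.1 hband)
      rw [h1, hK, received_apply_eq_zero h2]
      simp
  have hbound : bound = 1 / (blockLength M * δ * T) * ((∑ j, Real.log (1 + c * x j) +
      ∑ j, c * (((Kᴴ * Q * K) j j).re - x j) / (1 + c * x j)) / Real.log 2) := by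
    simp only [bound, κ]
    rw [htangent, hG.blockRate_opt hT hβ hδ hδβ hP hs, hG.transmitPower_opt hT hβ hδ hδβ, hA,
      transmitPower_eq]
    ring
  have hpre : 0 < 1 / (blockLength M * δ * T) := by positivity
  rw [hbound, hA, blockRate_eq]
  constructor
  · exact mul_le_mul_of_nonneg_left (div_le_div_of_nonneg_right hle hlog.le) hpre.le
  · intro hE
    have hBQ := heq ((div_left_inj' hlog.ne').1 (mul_left_cancel₀ hpre.ne' hE))
    have hBopt := hG.received_optCovariance (P := P) hT hβ hδ hδβ M
    have hsame : Kᴴ * Q * K = Kᴴ * optCovariance G δ T β P M * K := hBQ.trans hBopt.symm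
    calc K * Kᴴ * Q * (K * Kᴴ) = K * (Kᴴ * Q * K) * Kᴴ := by simp only [Matrix.mul_assoc]
      _ = K * (Kᴴ * optCovariance G δ T β P M * K) * Kᴴ := by rw [hsame]
      _ = _ := by simp only [Matrix.mul_assoc]

/-- Riemann sums of a function of the flat spectrum; `u 0 = 0` confines it to the band. -/
theorem tendsto_gridSample_flatSpectrum {u : ℝ → ℝ}
    (hu : u 0 = 0) :
    Tendsto (fun M : ℕ => 1 / (blockLength M : ℝ) *
        ∑ j, u (gridSample (flatSpectrum T β δ P) M j)) atTop
      (𝓝 (∫ f in Set.Icc (-(1 / 2) : ℝ) (1 / 2), u (flatSpectrum T β δ P f))) := by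
  have := tendsto_riemannSum (H := fun f => u (flatSpectrum T β δ P f))
    (B := |u (P * T / (1 + β))|) (fun f => ?_)
    (ae_continuousAt_of_band (b := δ * (1 + β) / 2) ?_ fun f hf => ?_)
  · rw [integral_Icc_eq_integral_Ioc, ← intervalIntegral.integral_of_le (by norm_num)]
    exact this
  · unfold flatSpectrum
    split_ifs
    · exact le_rfl
    · rw [hu, norm_zero]
      exact abs_nonneg _
  · refine (continuousOn_const (c := u (P * T / (1 + β)))).congr fun f hf => ?_
    simp only [flatSpectrum, if_pos (abs_lt.2 hf)]
  · simp only [flatSpectrum, if_neg (not_lt.2 hf), hu]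

theorem IsPulseSpectrum.tendsto_transmitPower_opt (hG : IsPulseSpectrum p T β G) (hT : 0 < T)
    (hβ : 0 ≤ β) (hδ : 0 < δ) (hδβ : δ < 1 / (1 + β)) (hP : 0 < P) :
    Tendsto (fun M : ℕ => transmitPower δ T (dftISI G δ T M) (optCovariance G δ T β P M))
      atTop (𝓝 P) := by
  have hlim := (tendsto_gridSample_flatSpectrum (T := T) (β := β) (δ := δ) (P := P) (u := id) rfl).const_mul
    (1 / (δ * T))
  simp only [id] at hlim
  rw [(integral_flatSpectrum hβ hδ hδβ).2] at hlim
  have : 1 / (δ * T) * (P * (δ * T)) = P := by field_simp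
  rw [this] at hlim
  refine hlim.congr fun M => ?_
  rw [hG.transmitPower_opt hT hβ hδ hδβ, ← mul_assoc]
  congr 1
  rw [div_mul_div_comm, one_mul]
  congr 1
  ring

theorem IsPulseSpectrum.tendsto_blockRate_opt (hG : IsPulseSpectrum p T β G) (hT : 0 < T)
    (hβ : 0 ≤ β) (hδ : 0 < δ) (hδβ : δ < 1 / (1 + β)) (hP : 0 < P) (hs : 0 < s) :
    Tendsto (fun M : ℕ => blockRate δ T h s (dftISI G δ T M) (optCovariance G δ T β P M))
      atTop (𝓝 (spectralRate G δ T h s (fun f => P * δ * T * phi G δ T β f))) := by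
  rw [hG.spectralRate_opt hT hβ hδ hδβ]
  have hlim := ((tendsto_gridSample_flatSpectrum (T := T) (β := β) (δ := δ) (P := P)
    (u := fun y => Real.log (1 + ‖h‖ ^ 2 / s * y)) (by simp)).div_const (Real.log 2)).const_mul
    (1 / (δ * T))
  refine hlim.congr fun M => ?_
  rw [hG.blockRate_opt hT hβ hδ hδβ hP hs]
  ring

end OptimalCovariance

end FTN

/-! ### Optimality in the large-block regime -/

theorem mainTheorem2 (p G : ℝ → ℝ) (T β δ P s : ℝ) (h : ℂ)
    (hT : 0 < T) (hβ : 0 ≤ β) (hδ : 0 < δ) (hδβ : δ < 1 / (1 + β))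
    (hP : 0 < P) (hs : 0 < s) (hh : h ≠ 0)
    (hG : FTN.IsPulseSpectrum p T β G) :
    -- the Toeplitz matrix of the pulse and its DFT form are asymptotically equivalent
    Tendsto (fun M : ℕ => 1 / (FTN.blockLength M : ℝ) *
        ∑ n, ∑ m, ‖(FTN.toeplitzISI p δ T M - FTN.dftISI G δ T M) n m‖ ^ 2) atTop (𝓝 0) ∧
    -- `P δ T φ` is the optimal input spectrum, unique where the channel does not vanish
    FTN.AdmissibleSpectrum G δ T P (fun f => P * δ * T * FTN.phi G δ T β f) ∧
    (∀ S : ℝ → ℝ, FTN.AdmissibleSpectrum G δ T P S →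
      FTN.spectralRate G δ T h s S ≤
          FTN.spectralRate G δ T h s (fun f => P * δ * T * FTN.phi G δ T β f) ∧
        (FTN.spectralRate G δ T h s S =
            FTN.spectralRate G δ T h s (fun f => P * δ * T * FTN.phi G δ T β f) →
          ∀ᵐ f ∂volume.restrict (Set.Icc (-(1 / 2) : ℝ) (1 / 2)),
            FTN.foldedSpectrum G δ T f ≠ 0 → S f = P * δ * T * FTN.phi G δ T β f)) ∧
    -- the diagonal entries are the samples of `φ`
    (∀ (M : ℕ) (i : ℤ), |i| ≤ M →
      FTN.lambdaTilde G δ T β M i = FTN.phi G δ T β ((i : ℝ) / (FTN.blockLength M : ℝ))) ∧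
    -- at every block length the matrix is optimal at its own power level, and every optimal
    -- covariance agrees with it as seen through the channel
    (∀ M : ℕ, (FTN.optCovariance G δ T β P M).PosSemidef ∧
      ∀ Q, FTN.AdmissibleCovariance δ T
          (FTN.transmitPower δ T (FTN.dftISI G δ T M) (FTN.optCovariance G δ T β P M))
          (FTN.dftISI G δ T M) Q →
        FTN.blockRate δ T h s (FTN.dftISI G δ T M) Q ≤
            FTN.blockRate δ T h s (FTN.dftISI G δ T M) (FTN.optCovariance G δ T β P M) ∧
          (FTN.blockRate δ T h s (FTN.dftISI G δ T M) Q =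
              FTN.blockRate δ T h s (FTN.dftISI G δ T M) (FTN.optCovariance G δ T β P M) →
            FTN.dftISI G δ T M * Q * FTN.dftISI G δ T M =
              FTN.dftISI G δ T M * FTN.optCovariance G δ T β P M * FTN.dftISI G δ T M)) ∧
    -- its power tends to `P`
    Tendsto (fun M : ℕ =>
        FTN.transmitPower δ T (FTN.dftISI G δ T M) (FTN.optCovariance G δ T β P M))
      atTop (𝓝 P) ∧
    -- its rate tends to the rate of the optimal spectrum
    Tendsto (fun M : ℕ =>
        FTN.blockRate δ T h s (FTN.dftISI G δ T M) (FTN.optCovariance G δ T β P M))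
      atTop (𝓝 (FTN.spectralRate G δ T h s (fun f => P * δ * T * FTN.phi G δ T β f))) ∧
    -- it is optimal under the power constraint `P` as the block length grows
    (∀ ε : ℝ, 0 < ε → ∀ᶠ M : ℕ in atTop,
      ∀ Q, FTN.AdmissibleCovariance δ T P (FTN.dftISI G δ T M) Q →
        FTN.blockRate δ T h s (FTN.dftISI G δ T M) Q ≤
          FTN.blockRate δ T h s (FTN.dftISI G δ T M) (FTN.optCovariance G δ T β P M) + ε) := by
  refine ⟨hG.tendsto_toeplitzISI_sub_dftISI hT hβ hδ hδβ,
    hG.admissibleSpectrum_opt hT hβ hδ hδβ hP,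
    fun S hS => hG.spectralRate_le_opt hT hβ hδ hδβ hP hs hh hS,
    fun M i _ => hG.lambdaTilde_eq_phi hT hβ hδ hδβ M i,
    fun M => ⟨hG.posSemidef_optCovariance hT hβ hδ hδβ hP M, fun Q hQ => ?_⟩,
    hG.tendsto_transmitPower_opt hT hβ hδ hδβ hP,
    hG.tendsto_blockRate_opt hT hβ hδ hδβ hP hs, fun ε hε => ?_⟩
  · obtain ⟨hle, heq⟩ := hG.blockRate_le hT hβ hδ hδβ hP hs hh M hQ.posSemidef
    have hlog : 0 < Real.log 2 := Real.log_pos one_lt_two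
    have hκ : 0 ≤ ‖h‖ ^ 2 / s / (1 + ‖h‖ ^ 2 / s * (P * T / (1 + β))) / Real.log 2 := by positivity
    -- at equal or smaller power the tangent bound is at most the rate of the optimal covariance
    have hpow := mul_nonpos_of_nonneg_of_nonpos hκ (sub_nonpos.2 hQ.power_le)
    exact ⟨by linarith, fun hE => heq (by linarith)⟩
  · have hlog : 0 < Real.log 2 := Real.log_pos one_lt_two
    set κ := ‖h‖ ^ 2 / s / (1 + ‖h‖ ^ 2 / s * (P * T / (1 + β))) / Real.log 2 with hκdef
    have hκ : 0 ≤ κ := by positivity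
    have hlim : Tendsto (fun M : ℕ => κ * (P - FTN.transmitPower δ T (FTN.dftISI G δ T M)
        (FTN.optCovariance G δ T β P M))) atTop (𝓝 0) := by
      simpa using ((hG.tendsto_transmitPower_opt hT hβ hδ hδβ hP).const_sub P).const_mul κ
    filter_upwards [hlim.eventually (gt_mem_nhds hε)] with M hM Q hQ
    have hle := (hG.blockRate_le hT hβ hδ hδβ hP hs hh M hQ.posSemidef).1
    have hpow := mul_le_mul_of_nonneg_left (sub_le_sub_right hQ.power_le
      (FTN.transmitPower δ T (FTN.dftISI G δ T M) (FTN.optCovariance G δ T β P M))) hκ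
    linarith
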